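/- **Theorem (composition formula for semi-classical pseudo-differential operators on $\hbar\mathbb Z^n$).** *Setting.* Fix $\hbar\in(0,1]$ and $n$, and let $\hbar\mathbb Z^n=\{\hbar l: l\in\mathbb Z^n\}\subset\mathbb R^n$ with the Euclidean norm $|k|$, and $\mathbb T^n=\mathbb R^n/\mathbb Z^n$ with normalised Haar measure $d\theta$. Let $v_j$ be the $j$-th standard basis vector, and for multi-indices $\alpha,\beta\in\mathbb N_0^n$ put $$\Delta_{\hbar,j}g(k)=\frac{g(k+\hbar v_j)-g(k)}{\hbar},\qquad \Delta^\alpha_{\hbar,k}=\Delta_{\hbar,1}^{\alpha_1}\cdots\Delta_{\hbar,n}^{\alpha_n},$$ $$D^{(\beta_j)}_{\hbar,\theta_j}=\hbar^{\beta_j}\prod_{\ell=0}^{\beta_j-1}\Big(\frac1{2\pi i}\frac{\partial}{\partial\theta_j}-\ell\Big),\qquad D^{(\beta)}_{\hbar,\theta}=D^{(\beta_1)}_{\hbar,\theta_1}\cdots D^{(\beta_n)}_{\hbar,\theta_n}.$$ For $\mu,\rho,\delta\in\mathbb R$, the class $S^\mu_{\rho,\delta}(\hbar\mathbb Z^n\times\mathbb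 T^n)$ consists of the functions $\sigma:\hbar\mathbb Z^n\times\mathbb T^n\to\mathbb C$ with $\sigma(k,\cdot)\in C^\infty(\mathbb T^n)$ for all $k$ such that for all $\alpha,\beta$ there is $C_{\alpha,\beta}>0$ with $$|D^{(\beta)}_{\hbar,\theta}\Delta^\alpha_{\hbar,k}\sigma(k,\theta)|\le C_{\alpha,\beta}(1+|k|)^{\mu-\rho|\alpha|+\delta|\beta|}\qquad\text{for all }k\in\hbar\mathbb Z^n,\ \theta\in\mathbb T^n.$$ Let $\mathcal S(\hbar\mathbb Z^n)$ be the space of functions $f:\hbar\mathbb Z^n\to\mathbb C$ such that for every $N\in\mathbb N_0$ there is a constant $C$ with $|f(k)|\le C(1+|k|)^{-N}$ for all $k$. For $f\in\mathcal S(\hbar\mathbb Z^n)$ put $\widehat f(\theta)=\sum_{k\in\hbar\mathbb Z^n}e^{-2\pi\frac i\hbar k\cdot\theta}f(k)$ and $$\mathrm{Op}(\sigma)f(k)=\int_{\mathbb T^n}e^{2\pi\frac i\hbar k\cdot\theta}\sigma(k,\theta)\widehat f(\theta)\,d\theta .$$ *Statement.* Let $0\le\delta<\rho\le1$, $\mu_1,\mu_2\in\mathbb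 R$, $\sigma\in S^{\mu_1}_{\rho,\delta}(\hbar\mathbb Z^n\times\mathbb T^n)$ and $\tau\in S^{\mu_2}_{\rho,\delta}(\hbar\mathbb Z^n\times\mathbb T^n)$. Then $\mathrm{Op}(\sigma)$ and $\mathrm{Op}(\tau)$ map $\mathcal S(\hbar\mathbb Z^n)$ into itself, and there is a symbol $\varsigma\in S^{\mu_1+\mu_2}_{\rho,\delta}(\hbar\mathbb Z^n\times\mathbb T^n)$ such that $\mathrm{Op}(\sigma)\circ\mathrm{Op}(\tau)=\mathrm{Op}(\varsigma)$ on $\mathcal S(\hbar\mathbb Z^n)$ and $$\varsigma(k,\theta)\sim\sum_\alpha\frac1{\alpha!}\,D^{(\alpha)}_{\hbar,\theta}\sigma(k,\theta)\,\Delta^\alpha_{\hbar,k}\tau(k,\theta),$$ that is, for every $N\in\mathbb N_0$, $$\varsigma-\sum_{|\alpha|<N}\frac1{\alpha!}\,D^{(\alpha)}_{\hbar,\theta}\sigma\;\Delta^\alpha_{\hbar,k}\tau\ \in\ S^{\mu_1+\mu_2-N(\rho-\delta)}_{\rho,\delta}(\hbar\mathbb Z^n\times\mathbb T^n).$$ 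-/

import Mathlib

namespace SemiclassicalLattice

open MeasureTheory

/-- The lattice `hℤⁿ = {x ∈ ℝⁿ : x = h l for some l ∈ ℤⁿ}`, as a subgroup of Euclidean space. -/
def lattice (h : ℝ) (n : ℕ) : AddSubgroup (EuclideanSpace ℝ (Fin n)) where
  carrier := {x | ∃ l : Fin n → ℤ, ∀ j, x j = h * (l j : ℝ)}
  zero_mem' := ⟨0, fun j => by simp⟩
  add_mem' := by
    rintro x y ⟨l, hl⟩ ⟨m, hm⟩
    refine ⟨l + m, fun j => ?_⟩
    simp [hl j, hm j, mul_add]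
  neg_mem' := by
    rintro x ⟨l, hl⟩
    refine ⟨-l, fun j => ?_⟩
    simp [hl j]

/-- The integer coordinates `k / h` of a lattice point `k ∈ hℤⁿ`. -/
noncomputable def latticeCoord {h : ℝ} {n : ℕ} (k : lattice h n) : Fin n → ℤ :=
  Classical.choose k.2

theorem latticeCoord_spec {h : ℝ} {n : ℕ} (k : lattice h n) (j : Fin n) :
    (k : EuclideanSpace ℝ (Fin n)) j = h * (latticeCoord k j : ℝ) :=
  Classical.choose_spec k.2 j

/-- The lattice point `h vⱼ`, where `vⱼ` is the `j`-th standard basis vector. -/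
noncomputable def latticeStep (h : ℝ) {n : ℕ} (j : Fin n) : lattice h n :=
  ⟨EuclideanSpace.single j h, Pi.single j 1, fun i => by
    by_cases hij : i = j
    · subst hij; simp
    · simp [hij]⟩

/-- The torus `𝕋ⁿ = ℝⁿ / ℤⁿ`. -/
abbrev Torus (n : ℕ) : Type := UnitAddTorus (Fin n)

/-- The normalised Haar measure `dθ` on `𝕋ⁿ` (total mass `1`). -/
noncomputable def torusMeasure (n : ℕ) : Measure (Torus n) :=
  Measure.pi fun _ => AddCircle.haarAddCircle

/-- The class of a point of `ℝⁿ` in `𝕋ⁿ`. -/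
def torusMk {n : ℕ} (x : Fin n → ℝ) : Torus n := fun j => (x j : UnitAddCircle)

/-- `f ∈ C^∞(𝕋ⁿ)`: the `ℤⁿ`-periodic function on `ℝⁿ` corresponding to `f` is smooth. -/
def SmoothOnTorus {n : ℕ} (f : Torus n → ℂ) : Prop :=
  ContDiff ℝ (⊤ : ℕ∞) fun x : Fin n → ℝ => f (torusMk x)

/-- The partial derivative `∂f/∂θⱼ` on `𝕋ⁿ`. -/
noncomputable def torusPartial {n : ℕ} (j : Fin n) (f : Torus n → ℂ) : Torus n → ℂ :=
  fun θ => deriv (fun t : ℝ => f (θ + Pi.single j (t : UnitAddCircle))) 0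

/-- The character `e_θ(k) = e^{2πi (k·θ)/h}` of `θ ∈ 𝕋ⁿ`, for `k ∈ hℤⁿ`. -/
noncomputable def latticeChar {h : ℝ} {n : ℕ} (k : lattice h n) (θ : Torus n) : ℂ :=
  UnitAddTorus.mFourier (latticeCoord k) θ

theorem latticeChar_torusMk {h : ℝ} (hh : h ≠ 0) {n : ℕ} (k : lattice h n) (x : Fin n → ℝ) :
    latticeChar k (torusMk x) = Complex.exp (2 * Real.pi * (Complex.I / h) *
      ((∑ j, (k : EuclideanSpace ℝ (Fin n)) j * x j : ℝ) : ℂ)) := by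
  have hc : (h : ℂ) ≠ 0 := by exact_mod_cast hh
  simp only [latticeChar, UnitAddTorus.mFourier, ContinuousMap.coe_mk, torusMk,
    fourier_coe_apply]
  rw [← Complex.exp_sum]
  congr 1
  push_cast
  rw [Finset.mul_sum]
  refine Finset.sum_congr rfl fun j _ => ?_
  rw [latticeCoord_spec k j]
  push_cast
  field_simp

/-- The semi-classical Fourier transform `f̂(θ) = ∑_{k ∈ hℤⁿ} e^{-2πi (k·θ)/h} f(k)`. -/
noncomputable def latticeFourier {h : ℝ} {n : ℕ} (f : lattice h n → ℂ) : Torus n → ℂ :=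
  fun θ => ∑' k : lattice h n, latticeChar k (-θ) * f k

/-- The Schwartz space `𝓢(hℤⁿ)` of rapidly decreasing functions on the lattice. -/
def schwartzSpace (h : ℝ) (n : ℕ) : Set (lattice h n → ℂ) :=
  {f | ∀ N : ℕ, ∃ C : ℝ, ∀ k : lattice h n, ‖f k‖ ≤ C * (1 + ‖k‖) ^ (-(N : ℝ))}

/-- The operator `Op(σ)f(k) = ∫_{𝕋ⁿ} e^{2πi (k·θ)/h} σ(k,θ) f̂(θ) dθ` with symbol `σ`. -/
noncomputable def Op {h : ℝ} {n : ℕ} (σ : lattice h n → Torus n → ℂ) (f : lattice h n → ℂ) :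
    lattice h n → ℂ :=
  fun k => ∫ θ, latticeChar k θ * σ k θ * latticeFourier f θ ∂(torusMeasure n)

/-- The difference operator `Δ_{h,j} g(k) = (g(k + h vⱼ) - g(k)) / h`. -/
noncomputable def diffOp {h : ℝ} {n : ℕ} (j : Fin n) (g : lattice h n → ℂ) : lattice h n → ℂ :=
  fun k => (g (k + latticeStep h j) - g k) / h

/-- `Δ_h^α = Δ_{h,1}^{α₁} ⋯ Δ_{h,n}^{αₙ}`. -/
noncomputable def diffMulti {h : ℝ} {n : ℕ} (α : Fin n → ℕ) (g : lattice h n → ℂ) :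
    lattice h n → ℂ :=
  (List.finRange n).foldr (fun j u => (diffOp j)^[α j] u) g

/-- `D_{h,θⱼ}^{(b)} = h^b ∏_{ℓ=0}^{b-1} ((1/2πi) ∂/∂θⱼ - ℓ)`. -/
noncomputable def torusD (h : ℝ) {n : ℕ} (j : Fin n) : ℕ → (Torus n → ℂ) → Torus n → ℂ
  | 0, f => f
  | b + 1, f => fun θ => (h : ℂ) *
      (1 / (2 * Real.pi * Complex.I) * torusPartial j (torusD h j b f) θ
        - (b : ℂ) * torusD h j b f θ)

/-- `D_{h,θ}^{(β)} = D_{h,θ₁}^{(β₁)} ⋯ D_{h,θₙ}^{(βₙ)}`. -/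
noncomputable def torusDMulti (h : ℝ) {n : ℕ} (β : Fin n → ℕ) (f : Torus n → ℂ) : Torus n → ℂ :=
  (List.finRange n).foldr (fun j u => torusD h j (β j) u) f

/-- The symbol class `S^μ_{ρ,δ}(hℤⁿ × 𝕋ⁿ)`. -/
def symbolClass (h : ℝ) (n : ℕ) (μ ρ δ : ℝ) : Set (lattice h n → Torus n → ℂ) :=
  {σ | (∀ k, SmoothOnTorus (σ k)) ∧
    ∀ α β : Fin n → ℕ, ∃ C : ℝ, 0 < C ∧ ∀ (k : lattice h n) (θ : Torus n),
      ‖torusDMulti h β (fun ω => diffMulti α (fun m => σ m ω) k) θ‖ ≤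
        C * (1 + ‖k‖) ^ (μ - ρ * ((∑ j, α j : ℕ) : ℝ) + δ * ((∑ j, β j : ℕ) : ℝ))}

/-- The term `(1/α!) D_{h,θ}^{(α)} σ(k,θ) · Δ_{h,k}^α τ(k,θ)`. -/
noncomputable def compositionTerm {h : ℝ} {n : ℕ} (σ τ : lattice h n → Torus n → ℂ)
    (α : Fin n → ℕ) : lattice h n → Torus n → ℂ :=
  fun k θ => 1 / ((∏ j, (α j).factorial : ℕ) : ℂ) *
    (torusDMulti h α (σ k) θ * diffMulti α (fun m => τ m θ) k)

/-- `ς ∼ ∑_α s_α` as an asymptotic sum in the classes `S^{m - N(ρ-δ)}_{ρ,δ}`: for every `N`, the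
difference `ς - ∑_{|α| < N} s_α` lies in `S^{m - N(ρ-δ)}_{ρ,δ}(hℤⁿ × 𝕋ⁿ)`.  The set
`Finset.piAntidiag Finset.univ i` consists of the multi-indices `α` with `|α| = i`. -/
def IsAsymptoticSum {h : ℝ} {n : ℕ} (m ρ δ : ℝ) (ς : lattice h n → Torus n → ℂ)
    (s : (Fin n → ℕ) → lattice h n → Torus n → ℂ) : Prop :=
  ∀ N : ℕ, (fun k θ => ς k θ -
      ∑ i ∈ Finset.range N, ∑ α ∈ Finset.piAntidiag (Finset.univ : Finset (Fin n)) i, s α k θ) ∈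
    symbolClass h n (m - (N : ℝ) * (ρ - δ)) ρ δ

end SemiclassicalLattice

namespace SemiclassicalLattice

open MeasureTheory Filter Topology UnitAddTorus

/-! ### Smooth functions, integration and Fourier coefficients on the torus. -/

section TorusCalculus

variable {n : ℕ}

/-! Let `s(k,l)` and `t(k,l)` be the Fourier coefficients in `θ` of `σ(k,·)` and `τ(k,·)`.
Integrating termwise, `Op(σ)f(k) = ∑_l s(k,l) f(k+hl)` (`Op_eq_tsum`), so these operators are
infinite matrices. Composing them gives the symbol whose `p`-th coefficient is `∑_l s(k,l)
t(k+hl,p-l)`, without oscillatory integrals (`Op_comp_eq`).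

To expand it, apply Newton's discrete Taylor formula at `k` to `k' ↦ t(k',p-l)`. Its terms are
`h^|α| (l choose α) Δ^α t(k,p-l)`. Since `α! h^|α| (l choose α)` is exactly the Fourier multiplier
of `D^(α)`, summing over `l` produces the composition terms with no error (`hasSum_compositionTerm`,
`synth_remCoeff_eq`).

The Taylor remainder is at most `‖l‖₁^N` times the largest difference of order `N` at the points
`k+hq` with `‖q‖₁ ≤ ‖l‖₁` (`norm_taylorRem_le`). Each power of `l` is absorbed by the decay of
`s(k,l)` at a cost `(1+|k|)^δ`, while the differences gain `(1+|k|)^(-ρN)`. Moving the base point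
from `k` to `k+hq` costs powers of `l` only when `l` is at least comparable to `k`; there extra
decay of `s` compensates because `δ < 1` (`exists_remSummand_bound`). The net order is
`μ₁+μ₂-(ρ-δ)N` plus a loss independent of `N`.

Derivatives and differences of the remainder are estimated crudely, again with a loss independent of
`N` (`symbolUpTo_synth`). For a prescribed number `d` of them, expanding to order `N+R` with `R`
large makes up for both losses, as `ρ > δ`. The `R` additional groups of terms have the required
order by symbol calculus (`isAsymptoticSum_compositionSymbol`). That calculus is run with the plain
momentum `(1/2πi)∂_j`, which obeys Leibniz' rule, in place of the falling-factorial operators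
`D^(β)`; for `δ ≥ 0` both define the same classes. -/

theorem isOpenQuotientMap_torusMk : IsOpenQuotientMap (torusMk : (Fin n → ℝ) → Torus n) :=
  IsOpenQuotientMap.piMap fun _ => QuotientAddGroup.isOpenQuotientMap_mk

theorem torusMk_surjective : Function.Surjective (torusMk : (Fin n → ℝ) → Torus n) :=
  isOpenQuotientMap_torusMk.surjective

theorem torusMk_add_single (x : Fin n → ℝ) (j : Fin n) (t : ℝ) :
    torusMk (x + t • Pi.single j 1) = torusMk x + Pi.single j (t : UnitAddCircle) := by
  funext i
  by_cases hij : i = j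
  · subst hij; simp [torusMk]
  · simp [torusMk, hij]

theorem SmoothOnTorus.continuous {f : Torus n → ℂ} (hf : SmoothOnTorus f) : Continuous f :=
  isOpenQuotientMap_torusMk.isQuotientMap.continuous_iff.2 (ContDiff.continuous hf)

theorem SmoothOnTorus.hasDerivAt {f : Torus n → ℂ} (hf : SmoothOnTorus f) (j : Fin n)
    (x : Fin n → ℝ) (t : ℝ) :
    HasDerivAt (fun t : ℝ => f (torusMk x + Pi.single j (t : UnitAddCircle)))
      (fderiv ℝ (fun y : Fin n → ℝ => f (torusMk y)) (x + t • Pi.single j 1) (Pi.single j 1)) t := by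
  have h1 : DifferentiableAt ℝ (fun y : Fin n → ℝ => f (torusMk y)) (x + t • Pi.single j 1) :=
    (ContDiff.differentiable hf (by simp)).differentiableAt
  have h2 : HasDerivAt (fun t : ℝ => x + t • (Pi.single j 1 : Fin n → ℝ)) (Pi.single j 1) t := by
    simpa using ((hasDerivAt_id t).smul_const (Pi.single j 1 : Fin n → ℝ)).const_add x
  have h3 := h1.hasFDerivAt.comp_hasDerivAt t h2
  simpa only [Function.comp_def, torusMk_add_single] using h3

theorem SmoothOnTorus.torusPartial_torusMk {f : Torus n → ℂ} (hf : SmoothOnTorus f) (j : Fin n)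
    (x : Fin n → ℝ) : torusPartial j f (torusMk x) =
      fderiv ℝ (fun y : Fin n → ℝ => f (torusMk y)) x (Pi.single j 1) := by
  have h := (hf.hasDerivAt j x 0).deriv
  rwa [zero_smul, add_zero] at h

theorem SmoothOnTorus.torusPartial {f : Torus n → ℂ} (hf : SmoothOnTorus f) (j : Fin n) :
    SmoothOnTorus (torusPartial j f) := by
  unfold SmoothOnTorus
  simp only [hf.torusPartial_torusMk j]
  exact (ContDiff.fderiv_right hf (m := (⊤ : ℕ∞)) (by simp)).clm_apply contDiff_const

theorem SmoothOnTorus.hasDerivAt_torusPartial {f : Torus n → ℂ} (hf : SmoothOnTorus f) (j : Fin n)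
    (θ : Torus n) (t : ℝ) :
    HasDerivAt (fun t : ℝ => f (θ + Pi.single j (t : UnitAddCircle)))
      (SemiclassicalLattice.torusPartial j f (θ + Pi.single j (t : UnitAddCircle))) t := by
  obtain ⟨x, rfl⟩ := torusMk_surjective θ
  rw [← torusMk_add_single, hf.torusPartial_torusMk]
  exact hf.hasDerivAt j x t

theorem SmoothOnTorus.hasDerivAt_zero {f : Torus n → ℂ} (hf : SmoothOnTorus f) (j : Fin n)
    (θ : Torus n) :
    HasDerivAt (fun t : ℝ => f (θ + Pi.single j (t : UnitAddCircle)))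
      (SemiclassicalLattice.torusPartial j f θ) 0 := by
  simpa using hf.hasDerivAt_torusPartial j θ 0

theorem SmoothOnTorus.mul {f g : Torus n → ℂ} (hf : SmoothOnTorus f) (hg : SmoothOnTorus g) :
    SmoothOnTorus fun θ => f θ * g θ := ContDiff.mul hf hg

theorem SmoothOnTorus.add {f g : Torus n → ℂ} (hf : SmoothOnTorus f) (hg : SmoothOnTorus g) :
    SmoothOnTorus fun θ => f θ + g θ := ContDiff.add hf hg

theorem SmoothOnTorus.sub {f g : Torus n → ℂ} (hf : SmoothOnTorus f) (hg : SmoothOnTorus g) :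
    SmoothOnTorus fun θ => f θ - g θ := ContDiff.sub hf hg

theorem SmoothOnTorus.const_mul {f : Torus n → ℂ} (hf : SmoothOnTorus f) (c : ℂ) :
    SmoothOnTorus fun θ => c * f θ := ContDiff.mul contDiff_const hf

theorem torusPartial_mul {f g : Torus n → ℂ} (hf : SmoothOnTorus f) (hg : SmoothOnTorus g)
    (j : Fin n) : torusPartial j (fun θ => f θ * g θ) =
      fun θ => torusPartial j f θ * g θ + f θ * torusPartial j g θ := by
  funext θ
  have h := ((hf.hasDerivAt_zero j θ).mul (hg.hasDerivAt_zero j θ)).deriv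
  rwa [AddCircle.coe_zero, Pi.single_zero, add_zero] at h

theorem torusPartial_add {f g : Torus n → ℂ} (hf : SmoothOnTorus f) (hg : SmoothOnTorus g)
    (j : Fin n) : torusPartial j (fun θ => f θ + g θ) =
      fun θ => torusPartial j f θ + torusPartial j g θ := by
  funext θ
  exact ((hf.hasDerivAt_zero j θ).add (hg.hasDerivAt_zero j θ)).deriv

theorem torusPartial_const_mul {f : Torus n → ℂ} (hf : SmoothOnTorus f) (c : ℂ)
    (j : Fin n) : torusPartial j (fun θ => c * f θ) = fun θ => c * torusPartial j f θ := by
  funext θ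
  exact ((hf.hasDerivAt_zero j θ).const_mul c).deriv

instance : IsProbabilityMeasure (torusMeasure n) := by
  unfold torusMeasure; infer_instance

instance : (torusMeasure n).IsAddLeftInvariant := by
  unfold torusMeasure; infer_instance

theorem Continuous.integrable_torus {f : Torus n → ℂ} (hf : Continuous f) :
    Integrable f (torusMeasure n) :=
  hf.integrable_of_hasCompactSupport (HasCompactSupport.of_compactSpace f)

/-- By translation invariance the integral of `f(θ + t eⱼ)` does not depend on `t`. Differentiate it
at `t = 0` under the integral sign; compactness bounds the derivative. -/
theorem integral_torusPartial {f : Torus n → ℂ} (hf : SmoothOnTorus f) (j : Fin n) :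
    ∫ θ, torusPartial j f θ ∂(torusMeasure n) = 0 := by
  have hc := (hf.torusPartial j).continuous
  obtain ⟨C, hC⟩ := isCompact_univ.exists_bound_of_continuousOn hc.continuousOn
  have hF : ∀ {g : Torus n → ℂ}, Continuous g → ∀ t : ℝ, Integrable
      (fun θ => g (θ + Pi.single j (t : UnitAddCircle))) (torusMeasure n) := fun hg t =>
    Continuous.integrable_torus (hg.comp (continuous_id.add continuous_const))
  have h1 : HasDerivAt
      (fun t : ℝ => ∫ θ, f (θ + Pi.single j (t : UnitAddCircle)) ∂(torusMeasure n))
      (∫ θ, torusPartial j f (θ + Pi.single j ((0 : ℝ) : UnitAddCircle)) ∂(torusMeasure n)) 0 := by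
    refine (hasDerivAt_integral_of_dominated_loc_of_deriv_le (μ := torusMeasure n)
      (F := fun (t : ℝ) θ => f (θ + Pi.single j (t : UnitAddCircle)))
      (F' := fun (t : ℝ) θ => torusPartial j f (θ + Pi.single j (t : UnitAddCircle)))
      (bound := fun _ => C) (x₀ := (0 : ℝ)) (s := Set.univ) univ_mem ?_ ?_ ?_ ?_ ?_ ?_).2
    · exact Eventually.of_forall fun t => (hF hf.continuous t).aestronglyMeasurable
    · exact hF hf.continuous 0
    · exact (hF hc 0).aestronglyMeasurable
    · exact Eventually.of_forall fun θ t _ => hC _ (Set.mem_univ _)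
    · exact integrable_const _
    · exact Eventually.of_forall fun θ t _ => hf.hasDerivAt_torusPartial j θ t
  have h2 : (fun t : ℝ => ∫ θ, f (θ + Pi.single j (t : UnitAddCircle)) ∂(torusMeasure n)) =
      fun _ => ∫ θ, f θ ∂(torusMeasure n) := by
    funext t
    rw [← integral_add_left_eq_self f (Pi.single j (t : UnitAddCircle) : Torus n)]
    simp only [add_comm]
  rw [h2] at h1
  have h3 := h1.unique (hasDerivAt_const (0 : ℝ) _)
  simpa only [AddCircle.coe_zero, Pi.single_zero, add_zero] using h3

theorem mFourierCoeff_eq (f : Torus n → ℂ) (m : Fin n → ℤ) :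
    mFourierCoeff f m = ∫ θ, mFourier (-m) θ * f θ ∂(torusMeasure n) := rfl

theorem mFourier_torusMk (m : Fin n → ℤ) (x : Fin n → ℝ) :
    mFourier m (torusMk x) = Complex.exp (2 * Real.pi * Complex.I * ∑ j, (m j : ℂ) * (x j : ℂ)) := by
  simp only [mFourier, ContinuousMap.coe_mk, torusMk, fourier_coe_apply]
  rw [← Complex.exp_sum, Finset.mul_sum]
  congr 1
  refine Finset.sum_congr rfl fun j _ => ?_
  simp
  ring

/-- The differential of `x ↦ 2πi m·x`. -/
noncomputable def phaseCLM (m : Fin n → ℤ) : (Fin n → ℝ) →L[ℝ] ℂ :=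
  ∑ j, (2 * Real.pi * Complex.I * (m j : ℂ)) •
    (Complex.ofRealCLM.comp (ContinuousLinearMap.proj (R := ℝ) (φ := fun _ : Fin n => ℝ) j))

theorem phaseCLM_apply (m : Fin n → ℤ) (x : Fin n → ℝ) :
    phaseCLM m x = 2 * Real.pi * Complex.I * ∑ j, (m j : ℂ) * (x j : ℂ) := by
  simp only [phaseCLM, sum_apply, smul_apply,
    ContinuousLinearMap.comp_apply, ContinuousLinearMap.proj_apply, Complex.ofRealCLM_apply,
    smul_eq_mul, Finset.mul_sum, mul_assoc]

theorem hasFDerivAt_mFourier (m : Fin n → ℤ) (x : Fin n → ℝ) :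
    HasFDerivAt (fun x : Fin n → ℝ => mFourier m (torusMk x))
      (mFourier m (torusMk x) • phaseCLM m) x := by
  have h : (fun x : Fin n → ℝ => mFourier m (torusMk x)) = fun x => Complex.exp (phaseCLM m x) := by
    funext x; rw [mFourier_torusMk, phaseCLM_apply]
  rw [h, mFourier_torusMk, ← phaseCLM_apply]
  exact (phaseCLM m).hasFDerivAt.cexp

theorem smoothOnTorus_mFourier (m : Fin n → ℤ) : SmoothOnTorus (mFourier m : Torus n → ℂ) := by
  have h : (fun x : Fin n → ℝ => mFourier m (torusMk x)) = fun x => Complex.exp (phaseCLM m x) := by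
    funext x; rw [mFourier_torusMk, phaseCLM_apply]
  unfold SmoothOnTorus
  rw [h]
  exact (phaseCLM m).contDiff.cexp

theorem torusPartial_mFourier (m : Fin n → ℤ) (j : Fin n) :
    torusPartial j (mFourier m : Torus n → ℂ) =
      fun θ => 2 * Real.pi * Complex.I * (m j : ℂ) * mFourier m θ := by
  funext θ
  obtain ⟨x, rfl⟩ := torusMk_surjective θ
  rw [(smoothOnTorus_mFourier m).torusPartial_torusMk, (hasFDerivAt_mFourier m x).fderiv]
  simp only [smul_apply, phaseCLM_apply, smul_eq_mul]
  rw [Finset.sum_eq_single j]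
  · simp; ring
  · intro i _ hij; simp [hij]
  · simp

/-- Integration by parts: the derivative of the product of `f` with the character has integral zero.
-/
theorem mFourierCoeff_torusPartial {f : Torus n → ℂ} (hf : SmoothOnTorus f) (j : Fin n)
    (m : Fin n → ℤ) :
    mFourierCoeff (torusPartial j f) m = 2 * Real.pi * Complex.I * (m j : ℂ) * mFourierCoeff f m := by
  have h := integral_torusPartial ((smoothOnTorus_mFourier (-m)).mul hf) j
  rw [torusPartial_mul (smoothOnTorus_mFourier (-m)) hf, torusPartial_mFourier, integral_add] at h
  · rw [mFourierCoeff_eq, mFourierCoeff_eq]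
    simp only [mul_assoc, integral_const_mul] at h ⊢
    simp only [Pi.neg_apply, Int.cast_neg] at h
    linear_combination h
  · exact Continuous.integrable_torus ((continuous_const.mul (mFourier _).continuous).mul hf.continuous)
  · exact Continuous.integrable_torus ((mFourier _).continuous.mul (hf.torusPartial j).continuous)

theorem norm_mFourier_apply (m : Fin n → ℤ) (θ : Torus n) : ‖mFourier m θ‖ = 1 := by
  simp only [mFourier, ContinuousMap.coe_mk, norm_prod, fourier_apply, Circle.norm_coe,
    Finset.prod_const_one]

theorem norm_mFourierCoeff_le {f : Torus n → ℂ} {C : ℝ} (hf : ∀ θ, ‖f θ‖ ≤ C) (m : Fin n → ℤ) :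
    ‖mFourierCoeff f m‖ ≤ C := by
  rw [mFourierCoeff_eq]
  refine (norm_integral_le_of_norm_le_const (C := C) (Eventually.of_forall fun θ => ?_)).trans ?_
  · rw [norm_mul, norm_mFourier_apply, one_mul]; exact hf θ
  · simp

theorem mFourierCoeff_add {f g : Torus n → ℂ} (hf : Continuous f) (hg : Continuous g)
    (m : Fin n → ℤ) :
    mFourierCoeff (fun θ => f θ + g θ) m = mFourierCoeff f m + mFourierCoeff g m := by
  simp only [mFourierCoeff_eq, mul_add]
  exact integral_add (Continuous.integrable_torus ((mFourier _).continuous.mul hf))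
    (Continuous.integrable_torus ((mFourier _).continuous.mul hg))

theorem mFourierCoeff_sub {f g : Torus n → ℂ} (hf : Continuous f) (hg : Continuous g)
    (m : Fin n → ℤ) :
    mFourierCoeff (fun θ => f θ - g θ) m = mFourierCoeff f m - mFourierCoeff g m := by
  simp only [mFourierCoeff_eq, mul_sub]
  exact integral_sub (Continuous.integrable_torus ((mFourier _).continuous.mul hf))
    (Continuous.integrable_torus ((mFourier _).continuous.mul hg))

theorem mFourierCoeff_const_mul (f : Torus n → ℂ) (c : ℂ) (m : Fin n → ℤ) :
    mFourierCoeff (fun θ => c * f θ) m = c * mFourierCoeff f m := by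
  simp only [mFourierCoeff_eq, mul_left_comm _ c, integral_const_mul]

end TorusCalculus

/-! ### Polynomial weights and rapid decay on `ℤⁿ`. -/

section Weights

variable {n : ℕ}

/-- The `ℓ¹` norm on `ℤⁿ`. -/
def lnorm (m : Fin n → ℤ) : ℝ := ∑ j, |(m j : ℝ)|

/-- The weight `1 + ‖m‖₁` on `ℤⁿ`. -/
def wt (m : Fin n → ℤ) : ℝ := 1 + lnorm m

theorem lnorm_nonneg (m : Fin n → ℤ) : 0 ≤ lnorm m := Finset.sum_nonneg fun _ _ => abs_nonneg _

theorem one_le_wt (m : Fin n → ℤ) : 1 ≤ wt m := by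
  have := lnorm_nonneg m
  unfold wt; linarith

theorem wt_pos (m : Fin n → ℤ) : 0 < wt m := zero_lt_one.trans_le (one_le_wt m)

theorem lnorm_add_le (a b : Fin n → ℤ) : lnorm (a + b) ≤ lnorm a + lnorm b := by
  unfold lnorm
  rw [← Finset.sum_add_distrib]
  refine Finset.sum_le_sum fun j _ => ?_
  simpa using abs_add_le (a j : ℝ) (b j)

theorem wt_add_le (a b : Fin n → ℤ) : wt (a + b) ≤ wt a * wt b := by
  have h1 := lnorm_add_le a b
  have h2 := mul_nonneg (lnorm_nonneg a) (lnorm_nonneg b)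
  unfold wt
  nlinarith

theorem abs_le_lnorm (m : Fin n → ℤ) (j : Fin n) : |(m j : ℝ)| ≤ lnorm m :=
  Finset.single_le_sum (f := fun j => |(m j : ℝ)|) (fun _ _ => abs_nonneg _) (Finset.mem_univ j)

theorem norm_coord_le_wt (m : Fin n → ℤ) (j : Fin n) : ‖(m j : ℂ)‖ ≤ wt m := by
  rw [Complex.norm_intCast]
  have := abs_le_lnorm m j
  unfold wt; linarith

/-- A finite set of indices lies in the box formed by its projections, and over a box the sum of
products factors. -/
theorem summable_prod_pi {ι κ : Type*} [Fintype ι] [DecidableEq ι] {f : κ → ℝ} (hf : ∀ x, 0 ≤ f x)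
    (hs : Summable f) : Summable fun m : ι → κ => ∏ j, f (m j) := by
  classical
  refine summable_of_sum_le (c := ∏ _j : ι, ∑' x, f x)
    (fun m => Finset.prod_nonneg fun j _ => hf _) fun u => ?_
  calc ∑ m ∈ u, ∏ j, f (m j)
      ≤ ∑ m ∈ Fintype.piFinset (fun j => u.image (fun m => m j)), ∏ j, f (m j) := by
        refine Finset.sum_le_sum_of_subset_of_nonneg (fun m hm => ?_)
          fun m _ _ => Finset.prod_nonneg fun j _ => hf _
        rw [Fintype.mem_piFinset]
        exact fun j => Finset.mem_image_of_mem _ hm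
    _ = ∏ j, ∑ x ∈ u.image (fun m => m j), f x := (Finset.prod_univ_sum _ _).symm
    _ ≤ _ := Finset.prod_le_prod (fun j _ => Finset.sum_nonneg fun x _ => hf x)
        fun j _ => hs.sum_le_tsum _ fun x _ => hf x

theorem summable_one_add_abs_int : Summable fun x : ℤ => ((1 + |(x : ℝ)|) ^ 2)⁻¹ := by
  have h : Summable fun x : ℕ => ((1 + (x : ℝ)) ^ 2)⁻¹ := by
    have := (summable_nat_add_iff 1).2 (Real.summable_nat_pow_inv.2 (one_lt_two))
    simpa [add_comm] using this
  refine Summable.of_nat_of_neg ?_ ?_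
  · simpa using h
  · simpa using h

/-- The weight dominates every `1 + |mⱼ|`, so its power `2n` dominates a product of `n` squares,
each with summable inverse. -/
theorem summable_wt (n : ℕ) : Summable fun m : Fin n → ℤ => (wt m ^ (2 * n))⁻¹ := by
  refine Summable.of_nonneg_of_le (fun m => inv_nonneg.2 (pow_nonneg (wt_pos m).le _)) (fun m => ?_)
    (summable_prod_pi (fun x => by positivity) summable_one_add_abs_int)
  rw [Finset.prod_inv_distrib]
  refine inv_anti₀ (Finset.prod_pos fun j _ => by positivity) ?_
  calc ∏ j, (1 + |(m j : ℝ)|) ^ 2 ≤ ∏ _j : Fin n, wt m ^ 2 := by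
        refine Finset.prod_le_prod (fun j _ => by positivity) fun j _ => ?_
        have := abs_le_lnorm m j
        unfold wt
        gcongr
    _ = _ := by simp [pow_mul]

/-- The sum `∑ₘ (1 + ‖m‖₁)^{-2n}`. -/
noncomputable def wtSum (n : ℕ) : ℝ := ∑' m : Fin n → ℤ, (wt m ^ (2 * n))⁻¹

theorem wtSum_nonneg (n : ℕ) : 0 ≤ wtSum n :=
  tsum_nonneg fun m => inv_nonneg.2 (pow_nonneg (wt_pos m).le _)

variable {E : Type*} [NormedAddCommGroup E]

theorem summable_norm_of_wt_bound {a : (Fin n → ℤ) → E} {C : ℝ}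
    (ha : ∀ m, ‖a m‖ * wt m ^ (2 * n) ≤ C) : Summable fun m => ‖a m‖ := by
  refine Summable.of_nonneg_of_le (fun m => norm_nonneg _) (fun m => ?_)
    ((summable_wt n).mul_left C)
  rw [← div_eq_mul_inv, le_div_iff₀ (pow_pos (wt_pos m) _)]
  exact ha m

theorem tsum_norm_le_of_wt_bound {a : (Fin n → ℤ) → E} {C : ℝ}
    (ha : ∀ m, ‖a m‖ * wt m ^ (2 * n) ≤ C) : ∑' m, ‖a m‖ ≤ C * wtSum n := by
  rw [wtSum, ← tsum_mul_left]
  refine (summable_norm_of_wt_bound ha).tsum_le_tsum (fun m => ?_) ((summable_wt n).mul_left C)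
  rw [← div_eq_mul_inv, le_div_iff₀ (pow_pos (wt_pos m) _)]
  exact ha m

/-- Rapidly decreasing functions on `ℤⁿ`. -/
def RapidDecay (a : (Fin n → ℤ) → ℂ) : Prop := ∀ M : ℕ, ∃ C : ℝ, ∀ m, ‖a m‖ * wt m ^ M ≤ C

theorem RapidDecay.summable_norm_mul {a : (Fin n → ℤ) → ℂ} (ha : RapidDecay a) (M : ℕ) :
    Summable fun m => ‖a m‖ * wt m ^ M := by
  obtain ⟨C, hC⟩ := ha (M + 2 * n)
  have := summable_norm_of_wt_bound (a := fun m => ‖a m‖ * wt m ^ M) (C := C) fun m => by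
    rw [Real.norm_of_nonneg (mul_nonneg (norm_nonneg _) (pow_nonneg (wt_pos m).le _)), mul_assoc,
      ← pow_add]
    exact hC m
  exact this.congr fun m =>
    Real.norm_of_nonneg (mul_nonneg (norm_nonneg _) (pow_nonneg (wt_pos m).le _))

theorem RapidDecay.summable_norm {a : (Fin n → ℤ) → ℂ} (ha : RapidDecay a) :
    Summable fun m => ‖a m‖ := by simpa using ha.summable_norm_mul 0

theorem RapidDecay.mul_of_le_wt {a c : (Fin n → ℤ) → ℂ} (ha : RapidDecay a) {K : ℝ}
    (hc : ∀ m, ‖c m‖ ≤ K * wt m) : RapidDecay fun m => c m * a m := by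
  intro M
  obtain ⟨C, hC⟩ := ha (M + 1)
  have hK : 0 ≤ K := by
    have h := (norm_nonneg _).trans (hc 0)
    exact nonneg_of_mul_nonneg_left h (wt_pos _)
  refine ⟨K * C, fun m => ?_⟩
  rw [norm_mul]
  calc ‖c m‖ * ‖a m‖ * wt m ^ M ≤ (K * wt m) * ‖a m‖ * wt m ^ M := by
        gcongr
        · exact pow_nonneg (wt_pos m).le _
        · exact hc m
    _ = K * (‖a m‖ * wt m ^ (M + 1)) := by ring
    _ ≤ _ := by gcongr; exact hC m

end Weights

/-! ### Fourier series with rapidly decreasing coefficients. -/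

section Synthesis

variable {n : ℕ}

/-- The Fourier series with coefficients `a`. -/
noncomputable def synth (a : (Fin n → ℤ) → ℂ) : Torus n → ℂ := fun θ => ∑' m, a m * mFourier m θ

theorem summable_synth {a : (Fin n → ℤ) → ℂ} (ha : Summable fun m => ‖a m‖) (θ : Torus n) :
    Summable fun m => a m * mFourier m θ :=
  Summable.of_norm (ha.congr fun m => by rw [norm_mul, norm_mFourier_apply, mul_one])

theorem norm_synth_le {a : (Fin n → ℤ) → ℂ} {C : ℝ} (ha : ∀ m, ‖a m‖ * wt m ^ (2 * n) ≤ C)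
    (θ : Torus n) : ‖synth a θ‖ ≤ C * wtSum n := by
  refine le_trans (norm_tsum_le_tsum_norm ?_) ?_
  · exact (summable_norm_of_wt_bound ha).congr fun m => by
      rw [norm_mul, norm_mFourier_apply, mul_one]
  · simp only [norm_mul, norm_mFourier_apply, mul_one]
    exact tsum_norm_le_of_wt_bound ha

theorem norm_phaseCLM_apply_le (m : Fin n → ℤ) (x : Fin n → ℝ) :
    ‖phaseCLM m x‖ ≤ 2 * Real.pi * wt m * ‖x‖ := by
  rw [phaseCLM_apply, norm_mul]
  have h1 : ‖(2 * Real.pi * Complex.I : ℂ)‖ = 2 * Real.pi := by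
    simp [abs_of_pos Real.pi_pos]
  rw [h1, mul_assoc (2 * Real.pi)]
  gcongr
  refine (norm_sum_le _ _).trans ?_
  calc ∑ j, ‖(m j : ℂ) * (x j : ℂ)‖ ≤ ∑ j, |(m j : ℝ)| * ‖x‖ := by
        refine Finset.sum_le_sum fun j _ => ?_
        rw [norm_mul, Complex.norm_intCast, Complex.norm_real]
        gcongr
        exact norm_le_pi_norm x j
    _ = lnorm m * ‖x‖ := by rw [lnorm, Finset.sum_mul]
    _ ≤ _ := by
        gcongr
        unfold wt; linarith

theorem norm_phaseCLM_le (m : Fin n → ℤ) : ‖phaseCLM m‖ ≤ 2 * Real.pi * wt m :=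
  ContinuousLinearMap.opNorm_le_bound _
    (mul_nonneg (by positivity) (wt_pos m).le) (norm_phaseCLM_apply_le m)

theorem RapidDecay.hasFDerivAt_synth {a : (Fin n → ℤ) → ℂ} (ha : RapidDecay a) (x : Fin n → ℝ) :
    HasFDerivAt (fun x => synth a (torusMk x))
      (∑' m, a m • (mFourier m (torusMk x) • phaseCLM m)) x := by
  refine hasFDerivAt_tsum (𝕜 := ℝ) (u := fun m => 2 * Real.pi * (‖a m‖ * wt m ^ 1))
    (f := fun m x => a m * mFourier m (torusMk x))
    (f' := fun m x => a m • (mFourier m (torusMk x) • phaseCLM m))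
    ((ha.summable_norm_mul 1).mul_left _) (fun m x => ?_) (fun m x => ?_) (x₀ := 0)
    (summable_synth ha.summable_norm _) x
  · exact (hasFDerivAt_mFourier m x).const_mul (a m)
  · rw [norm_smul, norm_smul, norm_mFourier_apply, one_mul, pow_one, mul_left_comm]
    gcongr
    exact norm_phaseCLM_le m

theorem RapidDecay.fderiv_synth {a : (Fin n → ℤ) → ℂ} (ha : RapidDecay a) (x y : Fin n → ℝ) :
    fderiv ℝ (fun x => synth a (torusMk x)) x y =
      synth (fun m => phaseCLM m y * a m) (torusMk x) := by
  rw [(ha.hasFDerivAt_synth x).fderiv]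
  have hs : Summable fun m => a m • (mFourier m (torusMk x) • phaseCLM m) := by
    refine Summable.of_norm_bounded ((ha.summable_norm_mul 1).mul_left (2 * Real.pi)) fun m => ?_
    rw [norm_smul, norm_smul, norm_mFourier_apply, one_mul, pow_one, mul_left_comm]
    gcongr
    exact norm_phaseCLM_le m
  have h := (ContinuousLinearMap.apply ℝ ℂ y).map_tsum hs
  simp only [ContinuousLinearMap.apply_apply] at h
  rw [h]
  refine tsum_congr fun m => ?_
  simp only [smul_apply, smul_eq_mul]
  ring

/-- A directional derivative of such a series is a series of the same kind, its coefficients growing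
by one factor linear in `m`. Hence the induction on the order of differentiability runs over all
rapidly decreasing sequences at once. -/
theorem RapidDecay.smooth_synth {a : (Fin n → ℤ) → ℂ} (ha : RapidDecay a) :
    SmoothOnTorus (synth a) := by
  have key : ∀ (N : ℕ) (a : (Fin n → ℤ) → ℂ), RapidDecay a →
      ContDiff ℝ N (fun x : Fin n → ℝ => synth a (torusMk x)) := by
    intro N
    induction N with
    | zero =>
      intro a ha
      refine contDiff_zero.2 (continuous_iff_continuousAt.2 fun x => ?_)
      exact (ha.hasFDerivAt_synth x).continuousAt
    | succ N ih =>
      intro a ha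
      push_cast
      rw [contDiff_succ_iff_fderiv_apply]
      refine ⟨fun x => (ha.hasFDerivAt_synth x).differentiableAt, by simp, fun y => ?_⟩
      simp only [ha.fderiv_synth]
      refine ih _ (ha.mul_of_le_wt (K := 2 * Real.pi * ‖y‖) fun m => ?_)
      exact (norm_phaseCLM_apply_le m y).trans (le_of_eq (by ring))
  exact contDiff_infty.2 fun N => key N a ha

theorem integral_mFourier (m : Fin n → ℤ) :
    ∫ θ, mFourier m θ ∂(torusMeasure n) = if m = 0 then 1 else 0 := by
  split_ifs with h
  · subst h; simp [mFourier_zero]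
  · obtain ⟨j, hj⟩ := Function.ne_iff.1 h
    have h1 := integral_torusPartial (smoothOnTorus_mFourier m) j
    rw [torusPartial_mFourier, integral_const_mul] at h1
    refine (mul_eq_zero.1 h1).resolve_left ?_
    have : (m j : ℂ) ≠ 0 := by exact_mod_cast hj
    simp [this, Real.pi_ne_zero]

/-- Integrating an absolutely convergent series of continuous functions term by term. -/
theorem integral_tsum_torus {ι : Type*} [Countable ι] {F : ι → Torus n → ℂ} {u : ι → ℝ}
    (hF : ∀ i, Continuous (F i)) (hu : Summable u) (hb : ∀ i θ, ‖F i θ‖ ≤ u i) :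
    ∫ θ, ∑' i, F i θ ∂(torusMeasure n) = ∑' i, ∫ θ, F i θ ∂(torusMeasure n) := by
  refine (integral_tsum_of_summable_integral_norm
    (fun i => Continuous.integrable_torus (hF i)) ?_).symm
  refine Summable.of_nonneg_of_le (fun i => integral_nonneg fun _ => norm_nonneg _) (fun i => ?_) hu
  calc ∫ θ, ‖F i θ‖ ∂(torusMeasure n) ≤ ∫ _θ, u i ∂(torusMeasure n) :=
        integral_mono (Continuous.integrable_torus (hF i)).norm (integrable_const _) (hb i)
    _ = u i := by simp

theorem mFourierCoeff_synth {a : (Fin n → ℤ) → ℂ} (ha : Summable fun m => ‖a m‖)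
    (m : Fin n → ℤ) : mFourierCoeff (synth a) m = a m := by
  rw [mFourierCoeff_eq]
  have h : ∀ θ, mFourier (-m) θ * synth a θ = ∑' p, a p * mFourier (p - m) θ := by
    intro θ
    rw [synth, ← tsum_mul_left]
    refine tsum_congr fun p => ?_
    rw [sub_eq_neg_add, mFourier_add]; ring
  simp only [h]
  rw [integral_tsum_torus (F := fun p θ => a p * mFourier (p - m) θ)
    (fun p => continuous_const.mul (mFourier _).continuous) ha
    fun p θ => by rw [norm_mul, norm_mFourier_apply, mul_one]]
  simp only [integral_const_mul, integral_mFourier, sub_eq_zero]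
  simp

theorem synth_mFourierCoeff {f : Torus n → ℂ} (hf : Continuous f)
    (hs : Summable fun m => ‖mFourierCoeff f m‖) : synth (mFourierCoeff f) = f := by
  funext θ
  have h := hasSum_mFourier_series_apply_of_summable (f := ⟨f, hf⟩) (Summable.of_norm hs) θ
  exact h.tsum_eq

end Synthesis

/-! ### Falling factorials against powers of the weight. -/

section FallingFactorial

/-- The falling factorial `x (x - 1) ⋯ (x - b + 1)` of an integer, as a complex number. -/
def fallingFact (x : ℤ) (b : ℕ) : ℂ := ∏ ℓ ∈ Finset.range b, ((x : ℂ) - (ℓ : ℂ))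

theorem fallingFact_succ (x : ℤ) (b : ℕ) :
    fallingFact x (b + 1) = ((x : ℂ) - (b : ℂ)) * fallingFact x b := by
  rw [fallingFact, Finset.prod_range_succ, mul_comm]; rfl

/-- The summand `1` is needed because the falling factorial vanishes at `0, …, M-1`, where `1 + |x|
≤ M + 1`. At any other integer each factor satisfies `|x - ℓ| ≥ 1`, so `1 + |x| ≤ M + |x - ℓ| ≤ (M +
1)|x - ℓ|`. -/
theorem one_add_abs_pow_le_fallingFact (x : ℤ) (M : ℕ) :
    (1 + |(x : ℝ)|) ^ M ≤ (M + 1 : ℝ) ^ M * (1 + ‖fallingFact x M‖) := by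
  by_cases h : 0 ≤ x ∧ x < M
  · have h1 : 1 + |(x : ℝ)| ≤ M + 1 := by
      rw [abs_of_nonneg (by exact_mod_cast h.1)]
      have : (x : ℝ) < M := by exact_mod_cast h.2
      linarith
    calc (1 + |(x : ℝ)|) ^ M ≤ (M + 1 : ℝ) ^ M := by gcongr
      _ ≤ _ := le_mul_of_one_le_right (by positivity) (by linarith [norm_nonneg (fallingFact x M)])
  · have h1 : (1 + |(x : ℝ)|) ^ M ≤ (M + 1 : ℝ) ^ M * ‖fallingFact x M‖ := by
      rw [fallingFact, norm_prod]
      have h2 : ∀ c : ℝ, c ^ M = ∏ _ℓ ∈ Finset.range M, c := by simp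
      rw [h2, h2, ← Finset.prod_mul_distrib]
      refine Finset.prod_le_prod (fun _ _ => by positivity) fun ℓ hℓ => ?_
      have hℓ' := Finset.mem_range.1 hℓ
      have h3 : ‖(x : ℂ) - (ℓ : ℂ)‖ = |(x : ℝ) - ℓ| := by
        rw [← Real.norm_eq_abs, ← Complex.norm_real]; simp
      rw [h3]
      have h4 : (1 : ℝ) ≤ |(x : ℝ) - ℓ| := by
        have : (1 : ℤ) ≤ |x - ℓ| := Int.one_le_abs (by omega)
        exact_mod_cast this
      have h5 : |(x : ℝ)| ≤ |(x : ℝ) - ℓ| + ℓ := by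
        have := abs_add_le ((x : ℝ) - ℓ) ℓ
        simpa using this
      have h6 : (ℓ : ℝ) + 1 ≤ M := by exact_mod_cast hℓ'
      nlinarith
    refine h1.trans ?_
    gcongr
    linarith

theorem wt_pow_le {n : ℕ} (m : Fin n → ℤ) (M : ℕ) :
    wt m ^ M ≤ (n + 1 : ℝ) ^ M * (1 + ∑ j, (1 + |(m j : ℝ)|) ^ M) := by
  rcases Nat.eq_zero_or_pos n with rfl | hn
  · simp [wt, lnorm]
  · have : Nonempty (Fin n) := ⟨⟨0, hn⟩⟩
    obtain ⟨i, hi⟩ := Finite.exists_max fun j => |(m j : ℝ)|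
    have h1 : wt m ≤ (n + 1 : ℝ) * (1 + |(m i : ℝ)|) := by
      have h2 : lnorm m ≤ n * |(m i : ℝ)| := by
        have := Finset.sum_le_card_nsmul Finset.univ (fun j => |(m j : ℝ)|) _ fun j _ => hi j
        simpa [lnorm] using this
      have := abs_nonneg (m i : ℝ)
      have h3 : (0 : ℝ) ≤ n := by positivity
      unfold wt; nlinarith
    calc wt m ^ M ≤ ((n + 1 : ℝ) * (1 + |(m i : ℝ)|)) ^ M := pow_le_pow_left₀ (wt_pos m).le h1 _
      _ = (n + 1 : ℝ) ^ M * (1 + |(m i : ℝ)|) ^ M := mul_pow _ _ _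
      _ ≤ _ := by
        gcongr
        have := Finset.single_le_sum (f := fun j => (1 + |(m j : ℝ)|) ^ M)
          (fun j _ => by positivity) (Finset.mem_univ i)
        linarith

end FallingFactorial

/-! ### The operators `D^(β)` as Fourier multipliers. -/

section TorusD

variable {n : ℕ} {h : ℝ}

theorem SmoothOnTorus.torusD {f : Torus n → ℂ} (hf : SmoothOnTorus f) (j : Fin n) (b : ℕ) :
    SmoothOnTorus (torusD h j b f) := by
  induction b with
  | zero => exact hf
  | succ b ih => exact (((ih.torusPartial j).const_mul _).sub (ih.const_mul _)).const_mul _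

theorem mFourierCoeff_torusD {f : Torus n → ℂ} (hf : SmoothOnTorus f) (j : Fin n) (b : ℕ)
    (m : Fin n → ℤ) :
    mFourierCoeff (torusD h j b f) m = (h : ℂ) ^ b * fallingFact (m j) b * mFourierCoeff f m := by
  induction b with
  | zero => simp [torusD, fallingFact]
  | succ b ih =>
    have hs := hf.torusD (h := h) j b
    simp only [torusD]
    rw [mFourierCoeff_const_mul, mFourierCoeff_sub ((hs.torusPartial j).const_mul _).continuous
      (hs.const_mul _).continuous, mFourierCoeff_const_mul, mFourierCoeff_const_mul,
      mFourierCoeff_torusPartial hs, ih, fallingFact_succ]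
    have hpi : (Real.pi : ℂ) ≠ 0 := by exact_mod_cast Real.pi_ne_zero
    have hI := Complex.I_ne_zero
    field_simp
    ring

/-- Smoothness and the multiplier formula go through the induction together, since the formula for
the outer operator requires a smooth argument. -/
theorem foldr_torusD {f : Torus n → ℂ} (hf : SmoothOnTorus f) (β : Fin n → ℕ) (L : List (Fin n)) :
    SmoothOnTorus (L.foldr (fun j u => torusD h j (β j) u) f) ∧
      ∀ m, mFourierCoeff (L.foldr (fun j u => torusD h j (β j) u) f) m =
        (L.map fun j => (h : ℂ) ^ β j * fallingFact (m j) (β j)).prod * mFourierCoeff f m := by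
  induction L with
  | nil => simpa using hf
  | cons j L ih =>
    refine ⟨ih.1.torusD j _, fun m => ?_⟩
    rw [List.foldr_cons, mFourierCoeff_torusD ih.1, ih.2, List.map_cons, List.prod_cons]
    ring

theorem SmoothOnTorus.torusDMulti {f : Torus n → ℂ} (hf : SmoothOnTorus f) (β : Fin n → ℕ) :
    SmoothOnTorus (torusDMulti h β f) := (foldr_torusD hf β _).1

theorem mFourierCoeff_torusDMulti {f : Torus n → ℂ} (hf : SmoothOnTorus f) (β : Fin n → ℕ)
    (m : Fin n → ℤ) :
    mFourierCoeff (torusDMulti h β f) m =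
      (∏ j, (h : ℂ) ^ β j * fallingFact (m j) (β j)) * mFourierCoeff f m := by
  rw [torusDMulti, (foldr_torusD hf β _).2, ← List.prod_ofFn, List.ofFn_eq_map]

theorem exists_bound_of_continuous {f : Torus n → ℂ} (hf : Continuous f) :
    ∃ C, ∀ θ, ‖f θ‖ ≤ C := by
  obtain ⟨C, hC⟩ := isCompact_univ.exists_bound_of_continuousOn hf.continuousOn
  exact ⟨C, fun θ => hC θ (Set.mem_univ _)⟩

/-- The constant in the decay estimate for Fourier coefficients. -/
noncomputable def decayConst (n : ℕ) (h : ℝ) (M : ℕ) : ℝ :=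
  (n + 1 : ℝ) ^ M * (1 + n * ((M + 1 : ℝ) ^ M * (1 + (h ^ M)⁻¹)))

/-- The bound on `D_j^(M) f` controls the `j`-th falling factorial times the coefficient; the bound
on `f` itself covers the frequencies where that factorial vanishes. The largest coordinate then
controls the weight. Only pure powers in one variable are needed. -/
theorem norm_mFourierCoeff_mul_wt_le (hh : 0 < h) {f : Torus n → ℂ} (hf : SmoothOnTorus f) (M : ℕ)
    {B : ℝ} (h0 : ∀ θ, ‖f θ‖ ≤ B) (h1 : ∀ j θ, ‖torusDMulti h (Pi.single j M) f θ‖ ≤ B)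
    (m : Fin n → ℤ) : ‖mFourierCoeff f m‖ * wt m ^ M ≤ decayConst n h M * B := by
  have hB : 0 ≤ B := (norm_nonneg _).trans (h0 0)
  have hc0 := norm_mFourierCoeff_le h0 m
  have hj : ∀ j, ‖mFourierCoeff f m‖ * (1 + |(m j : ℝ)|) ^ M ≤
      (M + 1 : ℝ) ^ M * (1 + (h ^ M)⁻¹) * B := by
    intro j
    have hc := norm_mFourierCoeff_le (h1 j) m
    rw [mFourierCoeff_torusDMulti hf, Finset.prod_eq_single j] at hc
    · rw [Pi.single_eq_same, norm_mul, norm_mul, norm_pow, Complex.norm_real,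
        Real.norm_of_nonneg hh.le] at hc
      have hp : 0 < h ^ M := pow_pos hh M
      have hc' : ‖fallingFact (m j) M‖ * ‖mFourierCoeff f m‖ ≤ (h ^ M)⁻¹ * B := by
        rw [← div_eq_inv_mul, le_div_iff₀ hp]
        linarith
      calc ‖mFourierCoeff f m‖ * (1 + |(m j : ℝ)|) ^ M
          ≤ ‖mFourierCoeff f m‖ * ((M + 1 : ℝ) ^ M * (1 + ‖fallingFact (m j) M‖)) := by
            gcongr
            exact one_add_abs_pow_le_fallingFact _ _
        _ = (M + 1 : ℝ) ^ M * (‖mFourierCoeff f m‖ +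
              ‖fallingFact (m j) M‖ * ‖mFourierCoeff f m‖) := by ring
        _ ≤ (M + 1 : ℝ) ^ M * (B + (h ^ M)⁻¹ * B) := by gcongr
        _ = _ := by ring
    · intro i _ hij
      simp [hij, fallingFact]
    · simp
  calc ‖mFourierCoeff f m‖ * wt m ^ M
      ≤ ‖mFourierCoeff f m‖ * ((n + 1 : ℝ) ^ M * (1 + ∑ j, (1 + |(m j : ℝ)|) ^ M)) := by
        gcongr
        exact wt_pow_le m M
    _ = (n + 1 : ℝ) ^ M * (‖mFourierCoeff f m‖ +
          ∑ j, ‖mFourierCoeff f m‖ * (1 + |(m j : ℝ)|) ^ M) := by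
        rw [← Finset.mul_sum]; ring
    _ ≤ (n + 1 : ℝ) ^ M * (B + ∑ _j : Fin n, (M + 1 : ℝ) ^ M * (1 + (h ^ M)⁻¹) * B) := by
        refine mul_le_mul_of_nonneg_left (add_le_add hc0 (Finset.sum_le_sum fun j _ => hj j)) ?_
        positivity
    _ = _ := by
        rw [Finset.sum_const, Finset.card_univ, Fintype.card_fin, nsmul_eq_mul, decayConst]
        ring

theorem SmoothOnTorus.rapidDecay {f : Torus n → ℂ} (hf : SmoothOnTorus f) :
    RapidDecay (mFourierCoeff f) := by
  intro M
  obtain ⟨C, hC⟩ := exists_bound_of_continuous hf.continuous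
  choose D hD using fun j : Fin n =>
    exists_bound_of_continuous (hf.torusDMulti (h := 1) (Pi.single j M)).continuous
  have hD0 : ∀ j, 0 ≤ D j := fun j => (norm_nonneg _).trans (hD j 0)
  have hC0 : 0 ≤ C := (norm_nonneg _).trans (hC 0)
  -- Smoothness does not involve the lattice parameter, so the estimate may be used with parameter
  -- `1`.
  refine ⟨_, norm_mFourierCoeff_mul_wt_le one_pos hf M (B := C + ∑ j, D j) (fun θ => ?_)
    fun j θ => ?_⟩
  · exact (hC θ).trans (le_add_of_nonneg_right (Finset.sum_nonneg fun j _ => hD0 j))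
  · refine (hD j θ).trans ?_
    have := Finset.single_le_sum (fun j _ => hD0 j) (Finset.mem_univ j)
    linarith

theorem SmoothOnTorus.synth_mFourierCoeff {f : Torus n → ℂ} (hf : SmoothOnTorus f) :
    synth (mFourierCoeff f) = f :=
  SemiclassicalLattice.synth_mFourierCoeff hf.continuous hf.rapidDecay.summable_norm

/-- This turns identities between differential operators into algebraic identities between
multipliers. -/
theorem SmoothOnTorus.ext_coeff {f g : Torus n → ℂ} (hf : SmoothOnTorus f) (hg : SmoothOnTorus g)
    (hfg : ∀ m, mFourierCoeff f m = mFourierCoeff g m) : f = g := by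
  rw [← hf.synth_mFourierCoeff, ← hg.synth_mFourierCoeff, funext hfg]

/-- The momentum operator `(1/2πi) ∂/∂θⱼ`. -/
noncomputable def momentum (j : Fin n) (f : Torus n → ℂ) : Torus n → ℂ :=
  fun θ => 1 / (2 * Real.pi * Complex.I) * torusPartial j f θ

theorem SmoothOnTorus.momentum {f : Torus n → ℂ} (hf : SmoothOnTorus f) (j : Fin n) :
    SmoothOnTorus (momentum j f) := (hf.torusPartial j).const_mul _

theorem mFourierCoeff_momentum {f : Torus n → ℂ} (hf : SmoothOnTorus f) (j : Fin n)
    (m : Fin n → ℤ) : mFourierCoeff (momentum j f) m = (m j : ℂ) * mFourierCoeff f m := by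
  unfold SemiclassicalLattice.momentum
  rw [mFourierCoeff_const_mul, mFourierCoeff_torusPartial hf]
  have hpi : (Real.pi : ℂ) ≠ 0 := by exact_mod_cast Real.pi_ne_zero
  have hI := Complex.I_ne_zero
  field_simp

theorem momentum_mul {f g : Torus n → ℂ} (hf : SmoothOnTorus f) (hg : SmoothOnTorus g)
    (j : Fin n) : momentum j (fun θ => f θ * g θ) =
      fun θ => momentum j f θ * g θ + f θ * momentum j g θ := by
  funext θ
  simp only [momentum, torusPartial_mul hf hg]
  ring

theorem momentum_add {f g : Torus n → ℂ} (hf : SmoothOnTorus f) (hg : SmoothOnTorus g)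
    (j : Fin n) : momentum j (fun θ => f θ + g θ) = fun θ => momentum j f θ + momentum j g θ := by
  funext θ
  simp only [momentum, torusPartial_add hf hg]
  ring

theorem momentum_const_mul {f : Torus n → ℂ} (hf : SmoothOnTorus f) (c : ℂ)
    (j : Fin n) : momentum j (fun θ => c * f θ) = fun θ => c * momentum j f θ := by
  funext θ
  simp only [momentum, torusPartial_const_mul hf]
  ring

theorem momentum_synth {a : (Fin n → ℤ) → ℂ} (ha : RapidDecay a) (j : Fin n) :
    momentum j (synth a) = synth fun m => (m j : ℂ) * a m := by
  have h1 : RapidDecay fun m : Fin n → ℤ => (m j : ℂ) * a m :=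
    ha.mul_of_le_wt (K := 1) fun m => by rw [one_mul]; exact norm_coord_le_wt m j
  refine (ha.smooth_synth.momentum j).ext_coeff h1.smooth_synth fun m => ?_
  rw [mFourierCoeff_momentum ha.smooth_synth, mFourierCoeff_synth ha.summable_norm,
    mFourierCoeff_synth h1.summable_norm]

theorem prod_single_succ {ι M : Type*} [Fintype ι] [DecidableEq ι] [CommMonoid M]
    (F G : ι → ℕ → M) (β : ι → ℕ) (j : ι) (c : M)
    (h1 : F j (β j + 1) = c * G j (β j)) (h2 : ∀ i ≠ j, F i (β i) = G i (β i)) :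
    ∏ i, F i ((β + Pi.single j 1 : ι → ℕ) i) = c * ∏ i, G i (β i) := by
  rw [← Finset.mul_prod_erase _ _ (Finset.mem_univ j), ← Finset.mul_prod_erase _ _
    (Finset.mem_univ j), ← mul_assoc]
  congr 1
  · simpa using h1
  · refine Finset.prod_congr rfl fun i hi => ?_
    have hi := Finset.ne_of_mem_erase hi
    simpa [hi] using h2 i hi

/-- On multipliers this is `x = (x - b) + b`: the first part lengthens the falling factorial by one
factor, the second leaves it unchanged. -/
theorem torusDMulti_momentum (hh : h ≠ 0) {f : Torus n → ℂ} (hf : SmoothOnTorus f) (β : Fin n → ℕ)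
    (j : Fin n) : torusDMulti h β (momentum j f) = fun θ =>
      (h : ℂ)⁻¹ * torusDMulti h (β + Pi.single j 1) f θ + (β j : ℂ) * torusDMulti h β f θ := by
  refine ((hf.momentum j).torusDMulti β).ext_coeff
    (((hf.torusDMulti _).const_mul _).add ((hf.torusDMulti _).const_mul _)) fun m => ?_
  rw [mFourierCoeff_add ((hf.torusDMulti _).const_mul _).continuous
    ((hf.torusDMulti _).const_mul _).continuous, mFourierCoeff_const_mul, mFourierCoeff_const_mul,
    mFourierCoeff_torusDMulti (hf.momentum j), mFourierCoeff_torusDMulti hf,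
    mFourierCoeff_torusDMulti hf, mFourierCoeff_momentum hf,
    prod_single_succ (fun i b => (h : ℂ) ^ b * fallingFact (m i) b)
      (fun i b => (h : ℂ) ^ b * fallingFact (m i) b) β j (h * ((m j : ℂ) - (β j : ℂ)))
      (by rw [fallingFact_succ]; ring) fun _ _ => rfl]
  have hc : (h : ℂ) ≠ 0 := by exact_mod_cast hh
  field_simp
  ring

end TorusD

/-! ### Difference operators on lattice functions and on symbols. -/

section Differences

variable {n : ℕ} {h : ℝ}

theorem multiIndex_induction {p : (Fin n → ℕ) → Prop} (zero : p 0)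
    (succ : ∀ α j, p α → p (α + Pi.single j 1)) (α : Fin n → ℕ) : p α := by
  obtain ⟨N, hN⟩ : ∃ N, N = ∑ j, α j := ⟨_, rfl⟩
  induction N generalizing α with
  | zero =>
    have : α = 0 := by
      funext j
      simpa using (Finset.sum_eq_zero_iff.1 hN.symm) j (Finset.mem_univ j)
    rwa [this]
  | succ N ih =>
    obtain ⟨j, hj⟩ : ∃ j, α j ≠ 0 := by
      by_contra! hc
      simp [hc] at hN
    have hα : α = (α - Pi.single j 1) + Pi.single j 1 := by
      funext i
      by_cases hij : i = j
      · subst hij; simp; omega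
      · simp [hij]
    rw [hα] at hN ⊢
    refine succ _ _ (ih _ ?_)
    simp only [Pi.add_apply, Finset.sum_add_distrib, Finset.sum_pi_single', Finset.mem_univ,
      if_true] at hN
    omega

theorem sum_add_single (α : Fin n → ℕ) (j : Fin n) :
    ∑ i, (α + Pi.single j 1 : Fin n → ℕ) i = ∑ i, α i + 1 := by
  simp [Finset.sum_add_distrib]

theorem diffOp_comm (i j : Fin n) (g : lattice h n → ℂ) :
    diffOp i (diffOp j g) = diffOp j (diffOp i g) := by
  funext k
  simp only [diffOp, add_right_comm k (latticeStep h i)]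
  ring

theorem diffMulti_zero (g : lattice h n → ℂ) : diffMulti 0 g = g := by
  simp [diffMulti]

theorem foldr_diffOp_comm (L : List (Fin n)) (α : Fin n → ℕ) (j : Fin n) (g : lattice h n → ℂ) :
    L.foldr (fun j u => (diffOp j)^[α j] u) (diffOp j g) =
      diffOp j (L.foldr (fun j u => (diffOp j)^[α j] u) g) := by
  induction L with
  | nil => rfl
  | cons i L ih =>
    rw [List.foldr_cons, ih, List.foldr_cons]
    exact Function.Commute.iterate_left (fun g => diffOp_comm i j g) (α i) _

theorem diffMulti_diffOp (α : Fin n → ℕ) (j : Fin n) (g : lattice h n → ℂ) :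
    diffMulti α (diffOp j g) = diffOp j (diffMulti α g) := foldr_diffOp_comm _ _ _ _

theorem diffMulti_add_single (α : Fin n → ℕ) (j : Fin n) (g : lattice h n → ℂ) :
    diffMulti (α + Pi.single j 1) g = diffOp j (diffMulti α g) := by
  -- The fold applies the coordinates in a fixed order, so the additional `Δ_j` is commuted outwards
  -- from its position. Absence of duplicates ensures that it appears only once.
  have key : ∀ L : List (Fin n), L.Nodup →
      L.foldr (fun i u => (diffOp i)^[(α + Pi.single j 1 : Fin n → ℕ) i] u) g =
        if j ∈ L then diffOp j (L.foldr (fun i u => (diffOp i)^[α i] u) g)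
        else L.foldr (fun i u => (diffOp i)^[α i] u) g := by
    intro L hL
    induction L with
    | nil => simp
    | cons i L ih =>
      rw [List.nodup_cons] at hL
      rw [List.foldr_cons, ih hL.2]
      by_cases hij : i = j
      · subst hij
        simp only [hL.1, if_false, List.mem_cons, true_or, if_true, List.foldr_cons, Pi.add_apply,
          Pi.single_eq_same, Function.iterate_succ_apply']
      · have hji : j ≠ i := fun h => hij h.symm
        have hα : (α + Pi.single j 1 : Fin n → ℕ) i = α i := by simp [hij]
        simp only [List.mem_cons, hji, false_or, hα, List.foldr_cons]
        split_ifs with hjL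
        · exact Function.Commute.iterate_left (fun g => diffOp_comm i j g) (α i) _
        · rfl
  have := key (List.finRange n) (List.nodup_finRange n)
  simpa [diffMulti] using this

/-- The difference operator acting on symbols. -/
noncomputable def symbolDiff (j : Fin n) (σ : lattice h n → Torus n → ℂ) :
    lattice h n → Torus n → ℂ := fun k θ => diffOp j (fun m => σ m θ) k

/-- The iterated difference operator acting on symbols. -/
noncomputable def symbolDiffMulti (α : Fin n → ℕ) (σ : lattice h n → Torus n → ℂ) :
    lattice h n → Torus n → ℂ := fun k θ => diffMulti α (fun m => σ m θ) k

/-- The momentum operator acting on symbols. -/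
noncomputable def symbolMomentum (j : Fin n) (σ : lattice h n → Torus n → ℂ) :
    lattice h n → Torus n → ℂ := fun k => momentum j (σ k)

theorem symbolDiffMulti_zero (σ : lattice h n → Torus n → ℂ) : symbolDiffMulti 0 σ = σ := by
  funext k θ
  simp [symbolDiffMulti, diffMulti_zero]

theorem symbolDiffMulti_add_single (α : Fin n → ℕ) (j : Fin n) (σ : lattice h n → Torus n → ℂ) :
    symbolDiffMulti (α + Pi.single j 1) σ = symbolDiff j (symbolDiffMulti α σ) := by
  funext k θ
  simp only [symbolDiffMulti, symbolDiff, diffMulti_add_single]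

theorem symbolDiffMulti_symbolDiff (α : Fin n → ℕ) (j : Fin n) (σ : lattice h n → Torus n → ℂ) :
    symbolDiffMulti α (symbolDiff j σ) = symbolDiffMulti (α + Pi.single j 1) σ := by
  funext k θ
  simp only [symbolDiffMulti, diffMulti_add_single, ← diffMulti_diffOp]
  rfl

theorem symbolDiff_eq (j : Fin n) (σ : lattice h n → Torus n → ℂ) (k : lattice h n) :
    symbolDiff j σ k = fun θ => (h : ℂ)⁻¹ * (σ (k + latticeStep h j) θ + (-1) * σ k θ) := by
  funext θ
  simp only [symbolDiff, diffOp]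
  ring

theorem smooth_symbolDiff {σ : lattice h n → Torus n → ℂ} (hσ : ∀ k, SmoothOnTorus (σ k))
    (j : Fin n) (k : lattice h n) : SmoothOnTorus (symbolDiff j σ k) := by
  rw [symbolDiff_eq]
  exact ((hσ _).add ((hσ _).const_mul _)).const_mul _

theorem smooth_symbolDiffMulti {σ : lattice h n → Torus n → ℂ} (hσ : ∀ k, SmoothOnTorus (σ k))
    (α : Fin n → ℕ) : ∀ k, SmoothOnTorus (symbolDiffMulti α σ k) := by
  induction α using multiIndex_induction with
  | zero => rwa [symbolDiffMulti_zero]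
  | succ α j ih =>
    rw [symbolDiffMulti_add_single]
    exact smooth_symbolDiff ih j

theorem mFourierCoeff_symbolDiff {σ : lattice h n → Torus n → ℂ} (hσ : ∀ k, SmoothOnTorus (σ k))
    (j : Fin n) (k : lattice h n) (m : Fin n → ℤ) :
    mFourierCoeff (symbolDiff j σ k) m = diffOp j (fun k => mFourierCoeff (σ k) m) k := by
  rw [symbolDiff_eq, mFourierCoeff_const_mul, mFourierCoeff_add (hσ _).continuous
    ((hσ _).const_mul _).continuous, mFourierCoeff_const_mul, diffOp]
  ring

theorem mFourierCoeff_symbolDiffMulti {σ : lattice h n → Torus n → ℂ}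
    (hσ : ∀ k, SmoothOnTorus (σ k)) (α : Fin n → ℕ) (m : Fin n → ℤ) :
    ∀ k, mFourierCoeff (symbolDiffMulti α σ k) m =
      diffMulti α (fun k => mFourierCoeff (σ k) m) k := by
  induction α using multiIndex_induction with
  | zero => simp [symbolDiffMulti_zero, diffMulti_zero]
  | succ α j ih =>
    intro k
    rw [symbolDiffMulti_add_single, mFourierCoeff_symbolDiff (smooth_symbolDiffMulti hσ α),
      diffMulti_add_single, funext ih]

theorem symbolDiff_symbolMomentum {σ : lattice h n → Torus n → ℂ} (hσ : ∀ k, SmoothOnTorus (σ k))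
    (i j : Fin n) : symbolDiff i (symbolMomentum j σ) = symbolMomentum j (symbolDiff i σ) := by
  funext k
  change _ = momentum j (symbolDiff i σ k)
  rw [symbolDiff_eq, symbolDiff_eq, momentum_const_mul
    ((hσ _).add ((hσ _).const_mul _)), momentum_add (hσ _) ((hσ _).const_mul _),
    momentum_const_mul (hσ _)]
  rfl

theorem symbolDiffMulti_symbolMomentum {σ : lattice h n → Torus n → ℂ}
    (hσ : ∀ k, SmoothOnTorus (σ k)) (α : Fin n → ℕ) (j : Fin n) :
    symbolDiffMulti α (symbolMomentum j σ) = symbolMomentum j (symbolDiffMulti α σ) := by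
  induction α using multiIndex_induction with
  | zero => simp only [symbolDiffMulti_zero]
  | succ α i ih =>
    rw [symbolDiffMulti_add_single, ih, symbolDiff_symbolMomentum (smooth_symbolDiffMulti hσ α),
      symbolDiffMulti_add_single]

/-- Discrete Leibniz rule. The quadratic correction has order lower by `2ρ`, which is harmless for
`ρ ≥ 0`. -/
theorem symbolDiff_mul (hh : h ≠ 0) (j : Fin n) (σ τ : lattice h n → Torus n → ℂ) :
    symbolDiff j (fun k θ => σ k θ * τ k θ) =
      fun k θ => (symbolDiff j σ k θ * τ k θ + σ k θ * symbolDiff j τ k θ) +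
        (h : ℂ) * (symbolDiff j σ k θ * symbolDiff j τ k θ) := by
  funext k θ
  have hc : (h : ℂ) ≠ 0 := by exact_mod_cast hh
  simp only [symbolDiff, diffOp]
  field_simp
  ring

theorem symbolDiff_add (j : Fin n) (σ τ : lattice h n → Torus n → ℂ) :
    symbolDiff j (fun k θ => σ k θ + τ k θ) =
      fun k θ => symbolDiff j σ k θ + symbolDiff j τ k θ := by
  funext k θ
  simp only [symbolDiff, diffOp]
  ring

theorem symbolDiff_const_mul (j : Fin n) (c : ℂ) (σ : lattice h n → Torus n → ℂ) :
    symbolDiff j (fun k θ => c * σ k θ) = fun k θ => c * symbolDiff j σ k θ := by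
  funext k θ
  simp only [symbolDiff, diffOp]
  ring

end Differences

/-! ### Symbol calculus with momentum and difference operators. -/

section Symbols

variable {n : ℕ} {h ρ δ : ℝ}

theorem one_le_one_add_norm (k : lattice h n) : 1 ≤ 1 + ‖k‖ := by
  linarith [norm_nonneg k]

theorem one_add_norm_pos (k : lattice h n) : 0 < 1 + ‖k‖ :=
  zero_lt_one.trans_le (one_le_one_add_norm k)

/-- Smooth symbols bounded by `(1 + |k|)^μ`. -/
def BoundedSymbol (μ : ℝ) (σ : lattice h n → Torus n → ℂ) : Prop :=
  (∀ k, SmoothOnTorus (σ k)) ∧ ∃ C, ∀ k θ, ‖σ k θ‖ ≤ C * (1 + ‖k‖) ^ μ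

/-- Symbols for which the estimates of order `μ` hold for all words of length at most `d` in the
momentum and difference operators. -/
def SymbolUpTo (ρ δ : ℝ) : ℕ → ℝ → (lattice h n → Torus n → ℂ) → Prop
  | 0, μ, σ => BoundedSymbol μ σ
  | d + 1, μ, σ => BoundedSymbol μ σ ∧ ∀ j, SymbolUpTo ρ δ d (μ + δ) (symbolMomentum j σ) ∧
      SymbolUpTo ρ δ d (μ - ρ) (symbolDiff j σ)

theorem BoundedSymbol.mono {μ μ' : ℝ} {σ : lattice h n → Torus n → ℂ} (hσ : BoundedSymbol μ σ)
    (hμ : μ ≤ μ') : BoundedSymbol μ' σ := by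
  obtain ⟨hs, C, hC⟩ := hσ
  refine ⟨hs, |C|, fun k θ => (hC k θ).trans ?_⟩
  have := Real.rpow_nonneg (one_add_norm_pos k).le μ
  calc C * (1 + ‖k‖) ^ μ ≤ |C| * (1 + ‖k‖) ^ μ := by gcongr; exact le_abs_self C
    _ ≤ |C| * (1 + ‖k‖) ^ μ' := by
      gcongr
      exact one_le_one_add_norm k

theorem BoundedSymbol.add {μ : ℝ} {σ τ : lattice h n → Torus n → ℂ} (hσ : BoundedSymbol μ σ)
    (hτ : BoundedSymbol μ τ) : BoundedSymbol μ fun k θ => σ k θ + τ k θ := by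
  obtain ⟨hs, C, hC⟩ := hσ
  obtain ⟨hs', C', hC'⟩ := hτ
  refine ⟨fun k => (hs k).add (hs' k), C + C', fun k θ => (norm_add_le _ _).trans ?_⟩
  rw [add_mul]
  exact add_le_add (hC k θ) (hC' k θ)

theorem BoundedSymbol.const_mul {μ : ℝ} {σ : lattice h n → Torus n → ℂ} (hσ : BoundedSymbol μ σ)
    (c : ℂ) : BoundedSymbol μ fun k θ => c * σ k θ := by
  obtain ⟨hs, C, hC⟩ := hσ
  refine ⟨fun k => (hs k).const_mul c, ‖c‖ * C, fun k θ => ?_⟩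
  rw [norm_mul, mul_assoc]
  exact mul_le_mul_of_nonneg_left (hC k θ) (norm_nonneg c)

theorem BoundedSymbol.mul {μ ν : ℝ} {σ τ : lattice h n → Torus n → ℂ} (hσ : BoundedSymbol μ σ)
    (hτ : BoundedSymbol ν τ) : BoundedSymbol (μ + ν) fun k θ => σ k θ * τ k θ := by
  obtain ⟨hs, C, hC⟩ := hσ
  obtain ⟨hs', C', hC'⟩ := hτ
  refine ⟨fun k => (hs k).mul (hs' k), C * C', fun k θ => ?_⟩
  rw [norm_mul, Real.rpow_add (one_add_norm_pos k), mul_mul_mul_comm]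
  exact mul_le_mul (hC k θ) (hC' k θ) (norm_nonneg _) ((norm_nonneg _).trans (hC k θ))

theorem SymbolUpTo.bounded {d : ℕ} {μ : ℝ} {σ : lattice h n → Torus n → ℂ}
    (hσ : SymbolUpTo ρ δ d μ σ) : BoundedSymbol μ σ := by
  cases d with
  | zero => exact hσ
  | succ d => exact hσ.1

theorem SymbolUpTo.pred {d : ℕ} {μ : ℝ} {σ : lattice h n → Torus n → ℂ}
    (hσ : SymbolUpTo ρ δ (d + 1) μ σ) : SymbolUpTo ρ δ d μ σ := by
  induction d generalizing μ σ with
  | zero => exact hσ.1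
  | succ d ih => exact ⟨hσ.1, fun j => ⟨ih (hσ.2 j).1, ih (hσ.2 j).2⟩⟩

theorem SymbolUpTo.mono {d : ℕ} {μ μ' : ℝ} {σ : lattice h n → Torus n → ℂ}
    (hσ : SymbolUpTo ρ δ d μ σ) (hμ : μ ≤ μ') : SymbolUpTo ρ δ d μ' σ := by
  induction d generalizing μ μ' σ with
  | zero => exact BoundedSymbol.mono hσ hμ
  | succ d ih =>
    exact ⟨hσ.1.mono hμ, fun j => ⟨ih (hσ.2 j).1 (by linarith), ih (hσ.2 j).2 (by linarith)⟩⟩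

theorem SymbolUpTo.add {d : ℕ} {μ : ℝ} {σ τ : lattice h n → Torus n → ℂ}
    (hσ : SymbolUpTo ρ δ d μ σ) (hτ : SymbolUpTo ρ δ d μ τ) :
    SymbolUpTo ρ δ d μ fun k θ => σ k θ + τ k θ := by
  induction d generalizing μ σ τ with
  | zero => exact BoundedSymbol.add hσ hτ
  | succ d ih =>
    refine ⟨hσ.1.add hτ.1, fun j => ⟨?_, ?_⟩⟩
    · have : symbolMomentum j (fun k θ => σ k θ + τ k θ) =
          fun k θ => symbolMomentum j σ k θ + symbolMomentum j τ k θ :=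
        funext fun k => momentum_add (hσ.1.1 k) (hτ.1.1 k) j
      rw [this]
      exact ih (hσ.2 j).1 (hτ.2 j).1
    · rw [symbolDiff_add]
      exact ih (hσ.2 j).2 (hτ.2 j).2

theorem SymbolUpTo.const_mul {d : ℕ} {μ : ℝ} {σ : lattice h n → Torus n → ℂ}
    (hσ : SymbolUpTo ρ δ d μ σ) (c : ℂ) : SymbolUpTo ρ δ d μ fun k θ => c * σ k θ := by
  induction d generalizing μ σ with
  | zero => exact BoundedSymbol.const_mul hσ c
  | succ d ih =>
    refine ⟨hσ.1.const_mul c, fun j => ⟨?_, ?_⟩⟩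
    · have : symbolMomentum j (fun k θ => c * σ k θ) = fun k θ => c * symbolMomentum j σ k θ :=
        funext fun k => momentum_const_mul (hσ.1.1 k) c j
      rw [this]
      exact ih (hσ.2 j).1
    · rw [symbolDiff_const_mul]
      exact ih (hσ.2 j).2

/-- Both Leibniz rules write a first derivative or difference of a product as a sum of products of
symbols controlled up to length `d`, so the induction closes. -/
theorem SymbolUpTo.mul (hh : h ≠ 0) (hρ : 0 ≤ ρ) {d : ℕ} {μ ν : ℝ} {σ τ : lattice h n → Torus n → ℂ}
    (hσ : SymbolUpTo ρ δ d μ σ) (hτ : SymbolUpTo ρ δ d ν τ) :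
    SymbolUpTo ρ δ d (μ + ν) fun k θ => σ k θ * τ k θ := by
  induction d generalizing μ ν σ τ with
  | zero => exact BoundedSymbol.mul hσ hτ
  | succ d ih =>
    refine ⟨hσ.1.mul hτ.1, fun j => ⟨?_, ?_⟩⟩
    · have : symbolMomentum j (fun k θ => σ k θ * τ k θ) = fun k θ =>
          symbolMomentum j σ k θ * τ k θ + σ k θ * symbolMomentum j τ k θ :=
        funext fun k => momentum_mul (hσ.1.1 k) (hτ.1.1 k) j
      rw [this]
      exact ((ih (hσ.2 j).1 hτ.pred).mono (by linarith)).add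
        ((ih hσ.pred (hτ.2 j).1).mono (by linarith))
    · rw [symbolDiff_mul hh]
      exact (((ih (hσ.2 j).2 hτ.pred).mono (by linarith)).add
        ((ih hσ.pred (hτ.2 j).2).mono (by linarith))).add
        (((ih (hσ.2 j).2 (hτ.2 j).2).mono (by linarith)).const_mul _)

/-- Symbols satisfying the estimates of order `μ` for words of all lengths. -/
def IsSymbol (ρ δ μ : ℝ) (σ : lattice h n → Torus n → ℂ) : Prop := ∀ d, SymbolUpTo ρ δ d μ σ

theorem IsSymbol.smooth {μ : ℝ} {σ : lattice h n → Torus n → ℂ} (hσ : IsSymbol ρ δ μ σ)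
    (k : lattice h n) : SmoothOnTorus (σ k) := (hσ 0).bounded.1 k

theorem IsSymbol.symbolMomentum {μ : ℝ} {σ : lattice h n → Torus n → ℂ} (hσ : IsSymbol ρ δ μ σ)
    (j : Fin n) : IsSymbol ρ δ (μ + δ) (symbolMomentum j σ) := fun d => ((hσ (d + 1)).2 j).1

theorem IsSymbol.symbolDiff {μ : ℝ} {σ : lattice h n → Torus n → ℂ} (hσ : IsSymbol ρ δ μ σ)
    (j : Fin n) : IsSymbol ρ δ (μ - ρ) (symbolDiff j σ) := fun d => ((hσ (d + 1)).2 j).2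

theorem IsSymbol.symbolDiffMulti {μ : ℝ} {σ : lattice h n → Torus n → ℂ} (hσ : IsSymbol ρ δ μ σ)
    (α : Fin n → ℕ) :
    IsSymbol ρ δ (μ - ρ * ((∑ j, α j : ℕ) : ℝ)) (symbolDiffMulti α σ) := by
  induction α using multiIndex_induction with
  | zero => simpa [symbolDiffMulti_zero] using hσ
  | succ α j ih =>
    rw [symbolDiffMulti_add_single, sum_add_single]
    have := ih.symbolDiff j
    push_cast at this ⊢
    rwa [mul_add, mul_one, ← sub_sub]

theorem torusDMulti_zero (f : Torus n → ℂ) : torusDMulti h 0 f = f := by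
  simp [torusDMulti, torusD]

theorem torusDMulti_add_single {f : Torus n → ℂ} (hf : SmoothOnTorus f) (β : Fin n → ℕ)
    (j : Fin n) : torusDMulti h (β + Pi.single j 1) f = fun θ =>
      (h : ℂ) * momentum j (torusDMulti h β f) θ + (-(h * (β j : ℂ))) * torusDMulti h β f θ := by
  have hs := hf.torusDMulti (h := h) β
  refine (hf.torusDMulti _).ext_coeff (((hs.momentum j).const_mul _).add (hs.const_mul _))
    fun m => ?_
  rw [mFourierCoeff_add ((hs.momentum j).const_mul _).continuous (hs.const_mul _).continuous,
    mFourierCoeff_const_mul, mFourierCoeff_const_mul, mFourierCoeff_momentum hs,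
    mFourierCoeff_torusDMulti hf, mFourierCoeff_torusDMulti hf,
    prod_single_succ (fun i b => (h : ℂ) ^ b * fallingFact (m i) b)
      (fun i b => (h : ℂ) ^ b * fallingFact (m i) b) β j (h * ((m j : ℂ) - (β j : ℂ)))
      (by rw [fallingFact_succ]; ring) fun _ _ => rfl]
  ring

/-- Each additional factor of `D^(β)` is a multiple of the momentum plus a multiple of the identity;
the latter is absorbed because `δ ≥ 0`. -/
theorem IsSymbol.torusDMulti (hδ : 0 ≤ δ) {μ : ℝ} {σ : lattice h n → Torus n → ℂ}
    (hσ : IsSymbol ρ δ μ σ) (β : Fin n → ℕ) :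
    IsSymbol ρ δ (μ + δ * ((∑ j, β j : ℕ) : ℝ)) fun k => torusDMulti h β (σ k) := by
  induction β using multiIndex_induction with
  | zero => simpa [torusDMulti_zero] using hσ
  | succ β j ih =>
    rw [sum_add_single]
    simp only [torusDMulti_add_single (hσ.smooth _)]
    push_cast at ih ⊢
    intro d
    exact ((((ih.symbolMomentum j) d).mono (by linarith)).const_mul _).add
      (((ih d).mono (by linarith)).const_mul _)

theorem IsSymbol.mem_symbolClass (hδ : 0 ≤ δ) {μ : ℝ} {σ : lattice h n → Torus n → ℂ}
    (hσ : IsSymbol ρ δ μ σ) : σ ∈ symbolClass h n μ ρ δ := by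
  refine ⟨hσ.smooth, fun α β => ?_⟩
  obtain ⟨C, hC⟩ := (((hσ.symbolDiffMulti α).torusDMulti hδ β) 0).bounded.2
  refine ⟨|C| + 1, by positivity, fun k θ => (hC k θ).trans ?_⟩
  have := one_add_norm_pos k
  gcongr
  linarith [le_abs_self C]

theorem symbolMomentum_mem_symbolClass (hh : h ≠ 0) (hδ : 0 ≤ δ) {μ : ℝ}
    {σ : lattice h n → Torus n → ℂ} (hσ : σ ∈ symbolClass h n μ ρ δ) (j : Fin n) :
    symbolMomentum j σ ∈ symbolClass h n (μ + δ) ρ δ := by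
  refine ⟨fun k => (hσ.1 k).momentum j, fun α β => ?_⟩
  obtain ⟨C₁, hC₁, h1⟩ := hσ.2 α (β + Pi.single j 1)
  obtain ⟨C₂, hC₂, h2⟩ := hσ.2 α β
  rw [sum_add_single] at h1
  refine ⟨‖(h : ℂ)⁻¹‖ * C₁ + ‖(β j : ℂ)‖ * C₂ + 1, by positivity, fun k θ => ?_⟩
  have e := symbolDiffMulti_symbolMomentum hσ.1 α j
  change ‖torusDMulti h β (symbolDiffMulti α (symbolMomentum j σ) k) θ‖ ≤ _
  rw [e]
  change ‖torusDMulti h β (momentum j (symbolDiffMulti α σ k)) θ‖ ≤ _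
  rw [torusDMulti_momentum hh (smooth_symbolDiffMulti hσ.1 α k)]
  have hk := one_le_one_add_norm k
  have hk0 := one_add_norm_pos k
  refine (norm_add_le _ _).trans ?_
  rw [norm_mul, norm_mul]
  set s := μ + δ - ρ * ((∑ j, α j : ℕ) : ℝ) + δ * ((∑ j, β j : ℕ) : ℝ) with hs
  have h1' : ‖torusDMulti h (β + Pi.single j 1) (symbolDiffMulti α σ k) θ‖ ≤
      C₁ * (1 + ‖k‖) ^ s := by
    refine (h1 k θ).trans (le_of_eq ?_)
    congr 2
    rw [hs]; push_cast; ring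
  have h2' : ‖torusDMulti h β (symbolDiffMulti α σ k) θ‖ ≤ C₂ * (1 + ‖k‖) ^ s := by
    refine (h2 k θ).trans ?_
    gcongr
    rw [hs]; linarith
  have h3 : 0 ≤ (1 + ‖k‖) ^ s := Real.rpow_nonneg hk0.le _
  calc _ ≤ ‖(h : ℂ)⁻¹‖ * (C₁ * (1 + ‖k‖) ^ s) + ‖(β j : ℂ)‖ * (C₂ * (1 + ‖k‖) ^ s) := by gcongr
    _ ≤ _ := by linarith

theorem symbolDiff_mem_symbolClass {μ : ℝ} {σ : lattice h n → Torus n → ℂ}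
    (hσ : σ ∈ symbolClass h n μ ρ δ) (j : Fin n) :
    symbolDiff j σ ∈ symbolClass h n (μ - ρ) ρ δ := by
  refine ⟨smooth_symbolDiff hσ.1 j, fun α β => ?_⟩
  obtain ⟨C, hC, h1⟩ := hσ.2 (α + Pi.single j 1) β
  rw [sum_add_single] at h1
  refine ⟨C, hC, fun k θ => ?_⟩
  change ‖torusDMulti h β (symbolDiffMulti α (symbolDiff j σ) k) θ‖ ≤ _
  rw [symbolDiffMulti_symbolDiff]
  refine (h1 k θ).trans (le_of_eq ?_)
  congr 2
  push_cast; ring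

theorem boundedSymbol_of_mem_symbolClass {μ : ℝ} {σ : lattice h n → Torus n → ℂ}
    (hσ : σ ∈ symbolClass h n μ ρ δ) : BoundedSymbol μ σ := by
  obtain ⟨C, _, hC⟩ := hσ.2 0 0
  refine ⟨hσ.1, C, fun k θ => ?_⟩
  simpa [torusDMulti_zero, diffMulti_zero] using hC k θ

/-- The class is mapped by momentum to order `μ + δ` and by differences to order `μ - ρ`, so
estimates for longer words follow by induction with the symbol and its order varying. -/
theorem isSymbol_of_mem_symbolClass (hh : h ≠ 0) (hδ : 0 ≤ δ) {μ : ℝ}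
    {σ : lattice h n → Torus n → ℂ} (hσ : σ ∈ symbolClass h n μ ρ δ) : IsSymbol ρ δ μ σ := by
  intro d
  induction d generalizing μ σ with
  | zero => exact boundedSymbol_of_mem_symbolClass hσ
  | succ d ih =>
    exact ⟨boundedSymbol_of_mem_symbolClass hσ, fun j =>
      ⟨ih (symbolMomentum_mem_symbolClass hh hδ hσ j), ih (symbolDiff_mem_symbolClass hσ j)⟩⟩

theorem isSymbol_compositionTerm (hh : h ≠ 0) (hδ : 0 ≤ δ) (hρ : 0 ≤ ρ) {μ₁ μ₂ : ℝ}
    {σ τ : lattice h n → Torus n → ℂ} (hσ : IsSymbol ρ δ μ₁ σ) (hτ : IsSymbol ρ δ μ₂ τ)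
    (α : Fin n → ℕ) :
    IsSymbol ρ δ (μ₁ + μ₂ - ((∑ j, α j : ℕ) : ℝ) * (ρ - δ)) (compositionTerm σ τ α) := fun d =>
  ((((hσ.torusDMulti hδ α) d).mul hh hρ ((hτ.symbolDiffMulti α) d)).const_mul _).mono
    (by linarith)

end Symbols

/-! ### Integer coordinates on the lattice. -/

section LatticePoints

variable {n : ℕ} {h : ℝ}

/-- The lattice point `h l` with integer coordinates `l`. -/
def latticePoint (h : ℝ) {n : ℕ} (l : Fin n → ℤ) : lattice h n :=
  ⟨WithLp.toLp 2 fun j => h * (l j : ℝ), l, fun _ => rfl⟩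

theorem latticePoint_apply (l : Fin n → ℤ) (j : Fin n) :
    (latticePoint h l : EuclideanSpace ℝ (Fin n)) j = h * (l j : ℝ) := rfl

theorem latticePoint_add (l m : Fin n → ℤ) :
    latticePoint h (l + m) = latticePoint h l + latticePoint h m := by
  ext j
  simp [latticePoint_apply, mul_add]

theorem latticePoint_zero : latticePoint h (0 : Fin n → ℤ) = 0 := by
  ext j
  simp [latticePoint_apply]

theorem latticePoint_single (j : Fin n) : latticePoint h (Pi.single j 1) = latticeStep h j := by
  ext i
  by_cases hij : i = j
  · subst hij; simp [latticePoint_apply, latticeStep]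
  · simp [latticePoint_apply, latticeStep, hij]

theorem latticePoint_latticeCoord (k : lattice h n) : latticePoint h (latticeCoord k) = k := by
  ext j
  rw [latticePoint_apply, latticeCoord_spec]

theorem latticePoint_injective (hh : h ≠ 0) :
    Function.Injective (latticePoint h : (Fin n → ℤ) → lattice h n) := by
  intro l m hlm
  funext j
  have h1 : h * (l j : ℝ) = h * (m j : ℝ) := by
    rw [← latticePoint_apply, hlm, latticePoint_apply]
  exact_mod_cast mul_left_cancel₀ hh h1

theorem latticeCoord_latticePoint (hh : h ≠ 0) (l : Fin n → ℤ) :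
    latticeCoord (latticePoint h l) = l :=
  latticePoint_injective hh (latticePoint_latticeCoord _)

theorem latticeCoord_add_latticePoint (hh : h ≠ 0) (k : lattice h n) (l : Fin n → ℤ) :
    latticeCoord (k + latticePoint h l) = latticeCoord k + l := by
  apply latticePoint_injective hh
  rw [latticePoint_latticeCoord, latticePoint_add, latticePoint_latticeCoord]

/-- Translation of integer coordinates to a lattice point `k`. -/
noncomputable def latticeEquiv (hh : h ≠ 0) (k : lattice h n) : (Fin n → ℤ) ≃ lattice h n where
  toFun l := k + latticePoint h l
  invFun m := latticeCoord (m - k)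
  left_inv l := by simp [latticeCoord_latticePoint hh]
  right_inv m := by simp [latticePoint_latticeCoord]

theorem norm_latticePoint_le (h0 : 0 < h) (h1 : h ≤ 1) (l : Fin n → ℤ) :
    ‖latticePoint h l‖ ≤ lnorm l := by
  change ‖(latticePoint h l : EuclideanSpace ℝ (Fin n))‖ ≤ _
  have hl := lnorm_nonneg l
  rw [EuclideanSpace.norm_eq, Real.sqrt_le_left hl]
  calc ∑ j, ‖(latticePoint h l : EuclideanSpace ℝ (Fin n)) j‖ ^ 2
      ≤ ∑ j, |(l j : ℝ)| * lnorm l := by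
        refine Finset.sum_le_sum fun j _ => ?_
        have h2 : ‖(latticePoint h l : EuclideanSpace ℝ (Fin n)) j‖ ≤ |(l j : ℝ)| := by
          rw [latticePoint_apply, norm_mul, Real.norm_of_nonneg h0.le, Real.norm_eq_abs]
          exact mul_le_of_le_one_left (abs_nonneg _) h1
        rw [sq]
        exact mul_le_mul h2 (h2.trans (abs_le_lnorm l j)) (norm_nonneg _) (abs_nonneg _)
    _ = lnorm l ^ 2 := by rw [← Finset.sum_mul, sq]; rfl

theorem one_add_norm_add_le (h0 : 0 < h) (h1 : h ≤ 1) (k : lattice h n) (q : Fin n → ℤ) :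
    1 + ‖k + latticePoint h q‖ ≤ 1 + ‖k‖ + lnorm q := by
  have := norm_add_le k (latticePoint h q)
  have := norm_latticePoint_le h0 h1 q
  linarith

theorem one_add_norm_le_add (h0 : 0 < h) (h1 : h ≤ 1) (k : lattice h n) (q : Fin n → ℤ) :
    1 + ‖k‖ ≤ 1 + ‖k + latticePoint h q‖ + lnorm q := by
  have := norm_sub_le (k + latticePoint h q) (latticePoint h q)
  have := norm_latticePoint_le h0 h1 q
  rw [add_sub_cancel_right] at *
  linarith

end LatticePoints

/-! ### Peetre's inequality and its refinement. -/

section Peetre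

/-- Comparability in both directions is assumed so that exponents of either sign are covered. -/
theorem rpow_le_of_ratio_le {x y r t : ℝ} {T : ℕ} (hx : 0 < x) (hy : 0 < y) (hr : 1 ≤ r)
    (hT : |t| ≤ T) (hyx : y ≤ x * r) (hxy : x ≤ y * r) : y ^ t ≤ x ^ t * r ^ T := by
  have hr0 : 0 < r := zero_lt_one.trans_le hr
  have hrT : r ^ |t| ≤ r ^ T := by
    rw [← Real.rpow_natCast]; exact Real.rpow_le_rpow_of_exponent_le hr hT
  refine le_trans ?_ (mul_le_mul_of_nonneg_left hrT (Real.rpow_nonneg hx.le t))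
  rcases le_total 0 t with ht | ht
  · rw [abs_of_nonneg ht, ← Real.mul_rpow hx.le hr0.le]
    exact Real.rpow_le_rpow hy.le hyx ht
  · rw [abs_of_nonpos ht, Real.rpow_neg hr0.le, ← div_eq_mul_inv, ← Real.div_rpow hx.le hr0.le]
    refine Real.rpow_le_rpow_of_nonpos (div_pos hx hr0) ?_ ht
    rwa [div_le_iff₀ hr0]

variable {n : ℕ} {h : ℝ}

/-- Peetre's inequality. -/
theorem rpow_one_add_norm_add_le (h0 : 0 < h) (h1 : h ≤ 1) {t : ℝ} {T : ℕ} (hT : |t| ≤ T)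
    (k : lattice h n) (q : Fin n → ℤ) :
    (1 + ‖k + latticePoint h q‖) ^ t ≤ (1 + ‖k‖) ^ t * wt q ^ T := by
  have h2 := one_add_norm_add_le h0 h1 k q
  have h3 := one_add_norm_le_add h0 h1 k q
  have h4 := mul_nonneg (norm_nonneg k) (lnorm_nonneg q)
  have h5 := mul_nonneg (norm_nonneg (k + latticePoint h q)) (lnorm_nonneg q)
  refine rpow_le_of_ratio_le (one_add_norm_pos _) (one_add_norm_pos _) (one_le_wt q) hT ?_ ?_
  · unfold wt; nlinarith
  · unfold wt; nlinarith

/-- A refinement of Peetre's inequality: the polynomial loss in `l` is only incurred together with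
an arbitrarily large negative power of `1 + |k|`. -/
theorem rpow_one_add_norm_add_le_split (h0 : 0 < h) (h1 : h ≤ 1) {t : ℝ} {T : ℕ} (hT : |t| ≤ T)
    (P : ℕ) (k : lattice h n) {q l : Fin n → ℤ} (hq : lnorm q ≤ lnorm l) :
    (1 + ‖k + latticePoint h q‖) ^ t ≤
      2 ^ (T + P) * ((1 + ‖k‖) ^ t * (1 + wt l ^ (T + P) * (1 + ‖k‖) ^ (-(P : ℝ)))) := by
  have hk := one_add_norm_pos k
  have hkt := Real.rpow_nonneg hk.le t
  have hkP := Real.rpow_nonneg hk.le (-(P : ℝ))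
  have hwl := one_le_wt l
  have hwp : 0 < wt l ^ (T + P) := pow_pos (wt_pos l) _
  -- If `2 wt l ≤ 1 + |k|`, the shift changes `1 + |k|` by a factor of at most `2` and nothing is
  -- lost in `l`.
  rcases le_or_gt (2 * wt l) (1 + ‖k‖) with hle | hlt
  · have h2 := one_add_norm_add_le h0 h1 k q
    have h3 := one_add_norm_le_add h0 h1 k q
    have h4 : (1 + ‖k + latticePoint h q‖) ^ t ≤ (1 + ‖k‖) ^ t * 2 ^ T := by
      refine rpow_le_of_ratio_le hk (one_add_norm_pos _) one_le_two hT ?_ ?_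
      · unfold wt at hle; linarith
      · unfold wt at hle; linarith
    calc _ ≤ (1 + ‖k‖) ^ t * 2 ^ T := h4
      _ = 2 ^ T * ((1 + ‖k‖) ^ t * 1) := by ring
      _ ≤ _ := by
        gcongr
        · exact one_le_two
        · omega
        · have := mul_nonneg hwp.le hkP
          linarith
  · have h4 := rpow_one_add_norm_add_le h0 h1 hT k q
    have h5 : wt q ^ T ≤ wt l ^ T := by
      refine pow_le_pow_left₀ (wt_pos q).le ?_ _
      unfold wt; linarith
    -- Here `1 + |k| < 2 wt l`, so this factor can be inserted at no cost; it trades powers of `l`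
    -- for decay in `k`.
    have h6 : 1 ≤ (2 * wt l) ^ P * (1 + ‖k‖) ^ (-(P : ℝ)) := by
      rw [Real.rpow_neg hk.le, Real.rpow_natCast, ← div_eq_mul_inv, one_le_div (pow_pos hk P)]
      exact pow_le_pow_left₀ hk.le hlt.le P
    calc _ ≤ (1 + ‖k‖) ^ t * wt q ^ T := h4
      _ ≤ (1 + ‖k‖) ^ t * wt l ^ T := by gcongr
      _ ≤ (1 + ‖k‖) ^ t * wt l ^ T * ((2 * wt l) ^ P * (1 + ‖k‖) ^ (-(P : ℝ))) :=
        le_mul_of_one_le_right (mul_nonneg hkt (pow_pos (wt_pos l) _).le) h6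
      _ = 2 ^ P * ((1 + ‖k‖) ^ t * (0 + wt l ^ (T + P) * (1 + ‖k‖) ^ (-(P : ℝ)))) := by
        rw [mul_pow, pow_add]; ring
      _ ≤ _ := by
        gcongr
        · exact one_le_two
        · omega
        · exact zero_le_one

end Peetre

/-! ### Newton's discrete Taylor formula. -/

section Taylor

variable {n : ℕ} {h : ℝ}

/-- Walk from `l` to `0` by unit steps, each bringing some coordinate closer to `0`. The walk has
`‖l‖₁` steps and never leaves the `ℓ¹` ball, and each step changes `F` by at most `B`. -/
theorem norm_le_of_path {F : (Fin n → ℤ) → ℂ} (hF0 : F 0 = 0) {r B : ℝ}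
    (hF : ∀ q j, lnorm q ≤ r → lnorm (q + Pi.single j 1) ≤ r →
      ‖F (q + Pi.single j 1) - F q‖ ≤ B) (l : Fin n → ℤ) (hl : lnorm l ≤ r) :
    ‖F l‖ ≤ lnorm l * B := by
  obtain ⟨N, hN⟩ : ∃ N, N = ∑ j, (l j).natAbs := ⟨_, rfl⟩
  have hcast : ∀ l : Fin n → ℤ, ((∑ j, (l j).natAbs : ℕ) : ℝ) = lnorm l := by
    intro l
    simp [lnorm, Nat.cast_natAbs]
  induction N generalizing l with
  | zero =>
    have : l = 0 := by
      funext j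
      simpa using (Finset.sum_eq_zero_iff.1 hN.symm) j (Finset.mem_univ j)
    rw [this, hF0, ← this, ← hcast, ← hN]
    simp
  | succ N ih =>
    obtain ⟨j, hj⟩ : ∃ j, l j ≠ 0 := by
      by_contra! hc
      simp [hc] at hN
    have hsum : ∀ m : Fin n → ℤ, (∀ i ≠ j, m i = l i) → (m j).natAbs + 1 = (l j).natAbs →
        N = ∑ i, (m i).natAbs := by
      intro m hm hmj
      rw [← Finset.add_sum_erase _ _ (Finset.mem_univ j)] at hN ⊢
      have : ∑ i ∈ Finset.univ.erase j, (m i).natAbs = ∑ i ∈ Finset.univ.erase j, (l i).natAbs :=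
        Finset.sum_congr rfl fun i hi => by rw [hm i (Finset.ne_of_mem_erase hi)]
      omega
    have hlN : lnorm l = N + 1 := by rw [← hcast, ← hN]; push_cast; ring
    have step : ∀ m : Fin n → ℤ, N = ∑ i, (m i).natAbs → (lnorm m ≤ r → ‖F l - F m‖ ≤ B) →
        ‖F l‖ ≤ lnorm l * B := by
      intro m hm hb
      have hmN : lnorm m = N := by rw [← hcast, ← hm]
      have hmr : lnorm m ≤ r := by linarith
      have h1 := ih m hmr hm
      have h2 := norm_add_le (F l - F m) (F m)
      rw [sub_add_cancel] at h2
      have h3 := hb hmr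
      rw [hmN] at h1
      rw [hlN]
      linarith
    rcases lt_or_gt_of_ne hj with hneg | hpos
    · refine step (l + Pi.single j 1) (hsum _ (fun i hi => by simp [hi]) (by simp; omega))
        fun hm => ?_
      rw [norm_sub_rev]
      exact hF l j hl hm
    · refine step (l - Pi.single j 1) (hsum _ (fun i hi => by simp [hi]) (by simp; omega))
        fun hm => ?_
      have := hF (l - Pi.single j 1) j hm (by rwa [sub_add_cancel])
      rwa [sub_add_cancel] at this

/-- The generalised binomial coefficient `∏ⱼ (lⱼ choose αⱼ)`. -/
def multiChoose (l : Fin n → ℤ) (α : Fin n → ℕ) : ℂ := ∏ j, ((Ring.choose (l j) (α j) : ℤ) : ℂ)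

theorem factorial_mul_choose_eq_fallingFact (x : ℤ) (b : ℕ) :
    (b.factorial : ℂ) * ((Ring.choose x b : ℤ) : ℂ) = fallingFact x b := by
  have h1 : (descPochhammer ℤ b).eval x = (b.factorial : ℤ) * Ring.choose x b := by
    rw [Polynomial.eval_eq_smeval, Ring.descPochhammer_eq_factorial_smul_choose, nsmul_eq_mul]
  have h2 : ∀ b, (((descPochhammer ℤ b).eval x : ℤ) : ℂ) = fallingFact x b := by
    intro b
    induction b with
    | zero => simp [fallingFact]
    | succ b ih =>
      rw [descPochhammer_succ_right, fallingFact_succ, Polynomial.eval_mul, ← ih]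
      simp [mul_comm]
  rw [← h2, h1]
  push_cast; rfl

theorem multiChoose_zero_right (l : Fin n → ℤ) : multiChoose l 0 = 1 := by
  simp [multiChoose]

theorem multiChoose_zero_left {α : Fin n → ℕ} (hα : α ≠ 0) :
    multiChoose (0 : Fin n → ℤ) α = 0 := by
  obtain ⟨j, hj⟩ := Function.ne_iff.1 hα
  refine Finset.prod_eq_zero (Finset.mem_univ j) ?_
  rw [Pi.zero_apply, Ring.choose_zero_pos ℤ (Nat.pos_of_ne_zero hj), Int.cast_zero]

theorem multiChoose_add_single_succ (l : Fin n → ℤ) (α : Fin n → ℕ) (j : Fin n) :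
    multiChoose (l + Pi.single j 1) (α + Pi.single j 1) =
      multiChoose l α + multiChoose l (α + Pi.single j 1) := by
  unfold multiChoose
  rw [← Finset.mul_prod_erase _ _ (Finset.mem_univ j), ← Finset.mul_prod_erase _ _
    (Finset.mem_univ j), ← Finset.mul_prod_erase _ _ (Finset.mem_univ j)]
  have h1 : ∀ l' : Fin n → ℤ, ∀ α' : Fin n → ℕ, (∀ i ≠ j, l' i = l i) → (∀ i ≠ j, α' i = α i) →
      ∏ i ∈ Finset.univ.erase j, ((Ring.choose (l' i) (α' i) : ℤ) : ℂ) =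
        ∏ i ∈ Finset.univ.erase j, ((Ring.choose (l i) (α i) : ℤ) : ℂ) := fun l' α' hl hα =>
    Finset.prod_congr rfl fun i hi => by
      rw [hl i (Finset.ne_of_mem_erase hi), hα i (Finset.ne_of_mem_erase hi)]
  rw [h1 (l + Pi.single j 1) (α + Pi.single j 1) (fun i hi => by simp [hi])
    (fun i hi => by simp [hi]), h1 l (α + Pi.single j 1) (fun _ _ => rfl)
    (fun i hi => by simp [hi]), ← add_mul]
  congr 1
  simp only [Pi.add_apply, Pi.single_eq_same]
  rw [Ring.choose_succ_succ]
  push_cast; rfl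

theorem multiChoose_add_single_of_eq_zero (l : Fin n → ℤ) {α : Fin n → ℕ} {j : Fin n}
    (hα : α j = 0) : multiChoose (l + Pi.single j 1) α = multiChoose l α := by
  refine Finset.prod_congr rfl fun i _ => ?_
  by_cases hij : i = j
  · subst hij; simp [hα]
  · simp [hij]

/-- The homogeneous part of degree `i` of the discrete Taylor expansion at `k`. -/
noncomputable def taylorTerm (i : ℕ) (g : lattice h n → ℂ) (k : lattice h n) (l : Fin n → ℤ) : ℂ :=
  ∑ α ∈ Finset.piAntidiag (Finset.univ : Finset (Fin n)) i,
    (h : ℂ) ^ i * multiChoose l α * diffMulti α g k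

theorem mem_piAntidiag_univ {i : ℕ} {α : Fin n → ℕ} :
    α ∈ Finset.piAntidiag (Finset.univ : Finset (Fin n)) i ↔ ∑ j, α j = i := by
  simp [Finset.mem_piAntidiag]

theorem taylorTerm_zero (g : lattice h n → ℂ) (k : lattice h n) (l : Fin n → ℤ) :
    taylorTerm 0 g k l = g k := by
  simp [taylorTerm, multiChoose_zero_right, diffMulti_zero]

theorem taylorTerm_succ_zero_right (i : ℕ) (g : lattice h n → ℂ) (k : lattice h n) :
    taylorTerm (i + 1) g k 0 = 0 := by
  refine Finset.sum_eq_zero fun α hα => ?_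
  rw [mem_piAntidiag_univ] at hα
  rw [multiChoose_zero_left, mul_zero, zero_mul]
  rintro rfl
  simp at hα

/-- Pascal's rule: multi-indices with `α j = 0` cancel in the difference, and the others are of the
form `α + eⱼ` with `|α| = i`. -/
theorem taylorTerm_step (i : ℕ) (g : lattice h n → ℂ) (k : lattice h n) (l : Fin n → ℤ)
    (j : Fin n) : taylorTerm (i + 1) g k (l + Pi.single j 1) - taylorTerm (i + 1) g k l =
      h * taylorTerm i (diffOp j g) k l := by
  unfold taylorTerm
  rw [← Finset.sum_sub_distrib, Finset.mul_sum]
  symm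
  refine Finset.sum_of_injOn (fun α => α + Pi.single j 1) (fun α _ β _ hab => add_right_cancel hab)
    (fun α hα => ?_) (fun α hα hα' => ?_) fun α _ => ?_
  · rw [Finset.mem_coe, mem_piAntidiag_univ] at hα ⊢
    rw [sum_add_single, hα]
  · have h0 : α j = 0 := by
      by_contra hc
      have hα2 : α = (α - Pi.single j 1) + Pi.single j 1 := by
        funext i
        by_cases hij : i = j
        · subst hij; simp; omega
        · simp [hij]
      refine hα' ⟨α - Pi.single j 1, ?_, hα2.symm⟩
      rw [mem_piAntidiag_univ] at hα
      rw [Finset.mem_coe, mem_piAntidiag_univ]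
      rw [hα2, sum_add_single] at hα
      omega
    rw [multiChoose_add_single_of_eq_zero l h0, sub_self]
  · rw [multiChoose_add_single_succ, diffMulti_add_single, diffMulti_diffOp]
    ring

/-- The remainder of order `N` in the discrete Taylor expansion at `k`. -/
noncomputable def taylorRem (N : ℕ) (g : lattice h n → ℂ) (k : lattice h n) (l : Fin n → ℤ) : ℂ :=
  g (k + latticePoint h l) - ∑ i ∈ Finset.range N, taylorTerm i g k l

theorem taylorRem_zero_right (N : ℕ) (g : lattice h n → ℂ) (k : lattice h n) :
    taylorRem (N + 1) g k 0 = 0 := by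
  rw [taylorRem, Finset.sum_range_succ', latticePoint_zero, add_zero, taylorTerm_zero]
  simp [taylorTerm_succ_zero_right]

/-- Discrete counterpart of the fact that differentiating a Taylor remainder gives the remainder,
one order lower, of the derivative. It drives the induction for the remainder estimate. -/
theorem taylorRem_step (hh : h ≠ 0) (N : ℕ) (g : lattice h n → ℂ) (k : lattice h n)
    (l : Fin n → ℤ) (j : Fin n) :
    taylorRem (N + 1) g k (l + Pi.single j 1) - taylorRem (N + 1) g k l =
      h * taylorRem N (diffOp j g) k l := by
  have hc : (h : ℂ) ≠ 0 := by exact_mod_cast hh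
  simp only [taylorRem, Finset.sum_range_succ', taylorTerm_zero, mul_sub, Finset.mul_sum,
    ← taylorTerm_step, Finset.sum_sub_distrib, latticePoint_add, latticePoint_single, diffOp,
    add_assoc]
  field_simp
  ring

theorem norm_taylorRem_le (h0 : 0 < h) (h1 : h ≤ 1) (N : ℕ) (g : lattice h n → ℂ)
    (k : lattice h n) (l : Fin n → ℤ) {B : ℝ} (hB0 : 0 ≤ B)
    (hB : ∀ α : Fin n → ℕ, ∑ j, α j = N → ∀ q, lnorm q ≤ lnorm l →
      ‖diffMulti α g (k + latticePoint h q)‖ ≤ B) :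
    ‖taylorRem N g k l‖ ≤ lnorm l ^ N * B := by
  -- The radius is separated from `l` because the inductive hypothesis is used at every point of the
  -- path from `0` to `l`, with one common bound.
  suffices H : ∀ (r : ℝ) (g : lattice h n → ℂ), (∀ α : Fin n → ℕ, ∑ j, α j = N → ∀ q, lnorm q ≤ r →
      ‖diffMulti α g (k + latticePoint h q)‖ ≤ B) → ∀ l, lnorm l ≤ r →
      ‖taylorRem N g k l‖ ≤ r ^ N * B from H _ g hB l le_rfl
  clear hB l g
  induction N with
  | zero =>
    intro r g hB l hl
    have := hB 0 (by simp) l hl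
    simpa [taylorRem, diffMulti_zero] using this
  | succ N ih =>
    intro r g hB l hl
    have hr : 0 ≤ r := (lnorm_nonneg l).trans hl
    have hj : ∀ q j, lnorm q ≤ r → ‖taylorRem N (diffOp j g) k q‖ ≤ r ^ N * B := fun q j hq =>
      ih r _ (fun α hα q hq => by
        rw [diffMulti_diffOp, ← diffMulti_add_single]
        exact hB _ (by rw [sum_add_single, hα]) q hq) q hq
    have h2 := norm_le_of_path (F := taylorRem (N + 1) g k) (taylorRem_zero_right N g k)
      (r := r) (B := r ^ N * B) (fun q j hq _ => by
        rw [taylorRem_step h0.ne', norm_mul, Complex.norm_real, Real.norm_of_nonneg h0.le]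
        have h3 := hj q j hq
        exact (mul_le_of_le_one_left (norm_nonneg _) h1).trans h3) l hl
    calc _ ≤ lnorm l * (r ^ N * B) := h2
      _ ≤ r * (r ^ N * B) := by gcongr
      _ = _ := by ring

end Taylor

/-! ### Decay of the Fourier coefficients of a symbol. -/

section CoefficientDecay

variable {n : ℕ} {h ρ δ : ℝ}

/-- Each power of the weight in `m` is paid for by one order of `D`, that is, by a factor
`(1+|k|)^δ`. -/
theorem exists_coeff_decay (h0 : 0 < h) (hδ : 0 ≤ δ) {μ : ℝ} {σ : lattice h n → Torus n → ℂ}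
    (hσ : σ ∈ symbolClass h n μ ρ δ) (α : Fin n → ℕ) (M : ℕ) : ∃ C : ℝ, 0 ≤ C ∧ ∀ k m,
      ‖diffMulti α (fun k => mFourierCoeff (σ k) m) k‖ * wt m ^ M ≤
        C * (1 + ‖k‖) ^ (μ - ρ * ((∑ j, α j : ℕ) : ℝ) + δ * M) := by
  obtain ⟨C₀, hC₀, hb₀⟩ := hσ.2 α 0
  choose C hC hb using fun j : Fin n => hσ.2 α (Pi.single j M)
  have hK : 0 ≤ decayConst n h M := by unfold decayConst; positivity
  have hCs : ∀ j, C j ≤ ∑ j, C j := fun j =>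
    Finset.single_le_sum (fun j _ => (hC j).le) (Finset.mem_univ j)
  have hCs0 : 0 ≤ ∑ j, C j := Finset.sum_nonneg fun j _ => (hC j).le
  refine ⟨decayConst n h M * (C₀ + ∑ j, C j), by positivity, fun k m => ?_⟩
  have hk := one_le_one_add_norm k
  have hk0 := one_add_norm_pos k
  rw [← mFourierCoeff_symbolDiffMulti hσ.1, mul_assoc (decayConst n h M)]
  refine norm_mFourierCoeff_mul_wt_le h0 (smooth_symbolDiffMulti hσ.1 α k) M (fun θ => ?_)
    (fun j θ => ?_) m
  · have h1 := hb₀ k θ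
    rw [torusDMulti_zero] at h1
    refine h1.trans ?_
    have h3 : ∑ j, (0 : Fin n → ℕ) j ≤ M := by simp
    gcongr
    linarith
  · refine (hb j k θ).trans ?_
    have h2 : ∑ i, (Pi.single j M : Fin n → ℕ) i = M := by simp
    rw [h2]
    gcongr
    have := hCs j
    linarith

theorem exists_coeff_decay_zero (h0 : 0 < h) (hδ : 0 ≤ δ) {μ : ℝ} {σ : lattice h n → Torus n → ℂ}
    (hσ : σ ∈ symbolClass h n μ ρ δ) (M : ℕ) : ∃ C : ℝ, 0 ≤ C ∧ ∀ k m,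
      ‖mFourierCoeff (σ k) m‖ * wt m ^ M ≤ C * (1 + ‖k‖) ^ (μ + δ * M) := by
  obtain ⟨C, hC, hb⟩ := exists_coeff_decay h0 hδ hσ 0 M
  refine ⟨C, hC, fun k m => ?_⟩
  simpa [diffMulti_zero] using hb k m

theorem exists_coeff_decay_uniform (h0 : 0 < h) (hδ : 0 ≤ δ) {μ : ℝ}
    {σ : lattice h n → Torus n → ℂ} (hσ : σ ∈ symbolClass h n μ ρ δ) (N M : ℕ) :
    ∃ C : ℝ, 0 ≤ C ∧ ∀ α : Fin n → ℕ, ∑ j, α j = N → ∀ k m,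
      ‖diffMulti α (fun k => mFourierCoeff (σ k) m) k‖ * wt m ^ M ≤
        C * (1 + ‖k‖) ^ (μ - ρ * N + δ * M) := by
  choose C hC hb using fun α => exists_coeff_decay h0 hδ hσ α M
  refine ⟨∑ α ∈ Finset.piAntidiag Finset.univ N, C α, Finset.sum_nonneg fun α _ => hC α,
    fun α hα k m => ?_⟩
  have h1 := hb α k m
  rw [hα] at h1
  refine h1.trans (mul_le_mul_of_nonneg_right ?_ (Real.rpow_nonneg (one_add_norm_pos k).le _))
  exact Finset.single_le_sum (fun α _ => hC α) (mem_piAntidiag_univ.2 hα)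

end CoefficientDecay

/-! ### Fourier coefficients of the composition and of its Taylor remainders. -/

section Remainder

variable {n : ℕ} {h ρ δ μ₁ μ₂ : ℝ} {σ τ : lattice h n → Torus n → ℂ}

/-- The summands of the Fourier coefficients of the remainder in the composition formula. -/
noncomputable def remSummand (σ τ : lattice h n → Torus n → ℂ) (N : ℕ) (k : lattice h n)
    (l p : Fin n → ℤ) : ℂ :=
  mFourierCoeff (σ k) l * taylorRem N (fun k' => mFourierCoeff (τ k') (p - l)) k l

/-- The Fourier coefficients of the remainder in the composition formula. -/
noncomputable def remCoeff (σ τ : lattice h n → Torus n → ℂ) (N : ℕ) (k : lattice h n)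
    (p : Fin n → ℤ) : ℂ := ∑' l, remSummand σ τ N k l p

/-- The decay of `σ` in `l` pays for `N` powers from Taylor's formula, `M` from `wt p ≤ wt (p-l) wt
l`, and `2n` for summability. The decay of `τ` in `p-l` pays for another `M`. This accounts for the
loss `δ(2M+2n)`, which is independent of `N`. -/
theorem exists_remSummand_bound (h0 : 0 < h) (h1 : h ≤ 1) (hδ : 0 ≤ δ) (hδ1 : δ < 1)
    (hσ : σ ∈ symbolClass h n μ₁ ρ δ) (hτ : τ ∈ symbolClass h n μ₂ ρ δ) (N M : ℕ) :
    ∃ C : ℝ, 0 ≤ C ∧ ∀ k l p, ‖remSummand σ τ N k l p‖ * wt l ^ (2 * n) * wt p ^ M ≤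
      C * (1 + ‖k‖) ^ (μ₁ + μ₂ - (ρ - δ) * N + δ * (2 * M + 2 * n)) := by
  set t := μ₂ - ρ * N + δ * M with ht
  obtain ⟨T, hT⟩ := exists_nat_ge |t|
  -- `P` is chosen so that `δ(T+P) ≤ P`: the `T+P` additional powers of `wt l` then cost no more
  -- than the factor `(1+|k|)^(-P)` that accompanies them.
  obtain ⟨P, hP⟩ := exists_nat_ge (δ * T / (1 - δ))
  have hP' : δ * ((T + P : ℕ) : ℝ) ≤ P := by
    rw [div_le_iff₀ (by linarith)] at hP
    push_cast; linarith
  obtain ⟨Cτ, hCτ, hbτ⟩ := exists_coeff_decay_uniform h0 hδ hτ N M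
  obtain ⟨C₁, hC₁, hb₁⟩ := exists_coeff_decay_zero h0 hδ hσ (N + M + 2 * n)
  obtain ⟨C₂, hC₂, hb₂⟩ := exists_coeff_decay_zero h0 hδ hσ (N + M + 2 * n + (T + P))
  refine ⟨Cτ * 2 ^ (T + P) * (C₁ + C₂), by positivity, fun k l p => ?_⟩
  have hk := one_le_one_add_norm k
  have hk0 := one_add_norm_pos k
  have hl0 := wt_pos l
  have hpl0 := wt_pos (p - l)
  have hkt := Real.rpow_nonneg hk0.le t
  have hkP := Real.rpow_nonneg hk0.le (-(P : ℝ))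
  set A := ‖mFourierCoeff (σ k) l‖ with hA
  have hA0 : 0 ≤ A := norm_nonneg _
  set W := (1 + ‖k‖) ^ t * (1 + wt l ^ (T + P) * (1 + ‖k‖) ^ (-(P : ℝ))) with hW
  have hW0 : 0 ≤ W := by positivity
  have hrem : ‖taylorRem N (fun k' => mFourierCoeff (τ k') (p - l)) k l‖ ≤
      lnorm l ^ N * (Cτ * (2 ^ (T + P) * W) / wt (p - l) ^ M) := by
    refine norm_taylorRem_le h0 h1 N _ k l (by positivity) fun α hα q hq => ?_
    rw [le_div_iff₀ (pow_pos hpl0 M)]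
    refine (hbτ α hα _ _).trans ?_
    exact mul_le_mul_of_nonneg_left (rpow_one_add_norm_add_le_split h0 h1 hT P k hq) hCτ
  have hlN : lnorm l ^ N ≤ wt l ^ N := by
    refine pow_le_pow_left₀ (lnorm_nonneg l) ?_ N
    unfold wt; linarith
  have hwp : wt p ^ M ≤ wt (p - l) ^ M * wt l ^ M := by
    rw [← mul_pow]
    refine pow_le_pow_left₀ (wt_pos p).le ?_ M
    simpa using wt_add_le (p - l) l
  have hrem2 : ‖taylorRem N (fun k' => mFourierCoeff (τ k') (p - l)) k l‖ * wt p ^ M ≤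
      wt l ^ (N + M) * (Cτ * (2 ^ (T + P) * W)) := by
    calc _ ≤ (wt l ^ N * (Cτ * (2 ^ (T + P) * W) / wt (p - l) ^ M)) *
          (wt (p - l) ^ M * wt l ^ M) := by
          refine mul_le_mul (hrem.trans ?_) hwp (pow_pos (wt_pos p) M).le (by positivity)
          gcongr
      _ = _ := by
          field_simp
          ring
  have e1 := hb₁ k l
  have e2 := hb₂ k l
  have e3 : (1 + ‖k‖) ^ (-(P : ℝ)) * (1 + ‖k‖) ^ (μ₁ + δ * ((N + M + 2 * n + (T + P) : ℕ) : ℝ)) ≤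
      (1 + ‖k‖) ^ (μ₁ + δ * ((N + M + 2 * n : ℕ) : ℝ)) := by
    rw [← Real.rpow_add hk0]
    refine Real.rpow_le_rpow_of_exponent_le hk ?_
    rw [Nat.cast_add (N + M + 2 * n)]
    linarith
  calc ‖remSummand σ τ N k l p‖ * wt l ^ (2 * n) * wt p ^ M
      = A * wt l ^ (2 * n) *
          (‖taylorRem N (fun k' => mFourierCoeff (τ k') (p - l)) k l‖ * wt p ^ M) := by
        rw [remSummand, norm_mul]; ring
    _ ≤ A * wt l ^ (2 * n) * (wt l ^ (N + M) * (Cτ * (2 ^ (T + P) * W))) := by gcongr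
    _ = Cτ * 2 ^ (T + P) * ((1 + ‖k‖) ^ t * (A * wt l ^ (N + M + 2 * n) + (1 + ‖k‖) ^ (-(P : ℝ)) *
          (A * wt l ^ (N + M + 2 * n + (T + P))))) := by
        rw [hW]; ring
    _ ≤ Cτ * 2 ^ (T + P) * ((1 + ‖k‖) ^ t *
          (C₁ * (1 + ‖k‖) ^ (μ₁ + δ * ((N + M + 2 * n : ℕ) : ℝ)) + (1 + ‖k‖) ^ (-(P : ℝ)) *
          (C₂ * (1 + ‖k‖) ^ (μ₁ + δ * ((N + M + 2 * n + (T + P) : ℕ) : ℝ))))) := by gcongr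
    _ ≤ Cτ * 2 ^ (T + P) * ((1 + ‖k‖) ^ t *
          (C₁ * (1 + ‖k‖) ^ (μ₁ + δ * ((N + M + 2 * n : ℕ) : ℝ)) +
          C₂ * (1 + ‖k‖) ^ (μ₁ + δ * ((N + M + 2 * n : ℕ) : ℝ)))) := by
        rw [mul_left_comm _ C₂]
        gcongr
    _ = Cτ * 2 ^ (T + P) * (C₁ + C₂) *
          ((1 + ‖k‖) ^ t * (1 + ‖k‖) ^ (μ₁ + δ * ((N + M + 2 * n : ℕ) : ℝ))) := by ring
    _ = _ := by
        rw [← Real.rpow_add hk0]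
        congr 2
        rw [ht]; push_cast; ring

theorem exists_remCoeff_bound (h0 : 0 < h) (h1 : h ≤ 1) (hδ : 0 ≤ δ) (hδ1 : δ < 1)
    (hσ : σ ∈ symbolClass h n μ₁ ρ δ) (hτ : τ ∈ symbolClass h n μ₂ ρ δ) (N M : ℕ) :
    ∃ C : ℝ, 0 ≤ C ∧ ∀ k p, ‖remCoeff σ τ N k p‖ * wt p ^ M ≤
      C * (1 + ‖k‖) ^ (μ₁ + μ₂ - (ρ - δ) * N + δ * (2 * M + 2 * n)) := by
  obtain ⟨C, hC, hb⟩ := exists_remSummand_bound h0 h1 hδ hδ1 hσ hτ N M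
  refine ⟨C * wtSum n, mul_nonneg hC (wtSum_nonneg n), fun k p => ?_⟩
  have hp := pow_pos (wt_pos p) M
  set X := (1 + ‖k‖) ^ (μ₁ + μ₂ - (ρ - δ) * N + δ * (2 * M + 2 * n)) with hX
  have hb' : ∀ l, ‖remSummand σ τ N k l p‖ * wt l ^ (2 * n) ≤ C * X / wt p ^ M := fun l =>
    (le_div_iff₀ hp).2 (hb k l p)
  have h2 : ‖remCoeff σ τ N k p‖ ≤ ∑' l, ‖remSummand σ τ N k l p‖ := by
    unfold remCoeff
    exact norm_tsum_le_tsum_norm (summable_norm_of_wt_bound hb')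
  have h3 := tsum_norm_le_of_wt_bound (a := fun l => remSummand σ τ N k l p) hb'
  have h4 : C * X / wt p ^ M * wtSum n * wt p ^ M = C * wtSum n * X := by
    field_simp
  rw [← h4]
  exact mul_le_mul_of_nonneg_right (h2.trans h3) hp.le

theorem rapidDecay_remCoeff (h0 : 0 < h) (h1 : h ≤ 1) (hδ : 0 ≤ δ) (hδ1 : δ < 1)
    (hσ : σ ∈ symbolClass h n μ₁ ρ δ) (hτ : τ ∈ symbolClass h n μ₂ ρ δ) (N : ℕ)
    (k : lattice h n) : RapidDecay (remCoeff σ τ N k) := fun M => by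
  obtain ⟨C, _, hb⟩ := exists_remCoeff_bound h0 h1 hδ hδ1 hσ hτ N M
  exact ⟨_, hb k⟩

theorem summable_remSummand (h0 : 0 < h) (h1 : h ≤ 1) (hδ : 0 ≤ δ) (hδ1 : δ < 1)
    (hσ : σ ∈ symbolClass h n μ₁ ρ δ) (hτ : τ ∈ symbolClass h n μ₂ ρ δ) (N : ℕ)
    (k : lattice h n) :
    Summable fun x : (Fin n → ℤ) × (Fin n → ℤ) => ‖remSummand σ τ N k x.1 x.2‖ := by
  obtain ⟨C, _, hb⟩ := exists_remSummand_bound h0 h1 hδ hδ1 hσ hτ N (2 * n)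
  have hw : ∀ m : Fin n → ℤ, 0 < wt m ^ (2 * n) := fun m => pow_pos (wt_pos m) _
  have hs := ((summable_wt n).mul_of_nonneg (summable_wt n) (fun m => (inv_pos.2 (hw m)).le)
    (fun m => (inv_pos.2 (hw m)).le)).mul_left
      (C * (1 + ‖k‖) ^ (μ₁ + μ₂ - (ρ - δ) * N + δ * (2 * (2 * n : ℕ) + 2 * n)))
  refine Summable.of_nonneg_of_le (fun _ => norm_nonneg _) (fun x => ?_) hs
  rw [← mul_inv, ← div_eq_mul_inv, le_div_iff₀ (mul_pos (hw _) (hw _)), ← mul_assoc]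
  exact hb k x.1 x.2

theorem hasSum_mFourierCoeff {f : Torus n → ℂ} (hf : SmoothOnTorus f) (θ : Torus n) :
    HasSum (fun m => mFourierCoeff f m * mFourier m θ) (f θ) := by
  have h1 := (summable_synth hf.rapidDecay.summable_norm θ).hasSum
  rwa [show ∑' m, mFourierCoeff f m * mFourier m θ = f θ from
    congrFun hf.synth_mFourierCoeff θ] at h1

theorem hasSum_taylorTerm (hτ : ∀ k, SmoothOnTorus (τ k)) (i : ℕ) (k : lattice h n)
    (l : Fin n → ℤ) (θ : Torus n) :
    HasSum (fun m => taylorTerm i (fun k' => mFourierCoeff (τ k') m) k l * mFourier m θ)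
      (taylorTerm i (fun k' => τ k' θ) k l) := by
  simp only [taylorTerm, Finset.sum_mul]
  refine hasSum_sum fun α _ => ?_
  have h1 := (hasSum_mFourierCoeff (smooth_symbolDiffMulti hτ α k) θ).mul_left
    ((h : ℂ) ^ i * multiChoose l α)
  simp only [mFourierCoeff_symbolDiffMulti hτ, ← mul_assoc] at h1
  exact h1

theorem hasSum_taylorRem (hτ : ∀ k, SmoothOnTorus (τ k)) (N : ℕ) (k : lattice h n)
    (l : Fin n → ℤ) (θ : Torus n) :
    HasSum (fun m => taylorRem N (fun k' => mFourierCoeff (τ k') m) k l * mFourier m θ)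
      (taylorRem N (fun k' => τ k' θ) k l) := by
  simp only [taylorRem, sub_mul, Finset.sum_mul]
  exact (hasSum_mFourierCoeff (hτ _) θ).sub
    (hasSum_sum fun i _ => hasSum_taylorTerm hτ i k l θ)

/-- An absolutely convergent double series is summed in two orders. Summing over `l` first gives the
coefficients `remCoeff`; summing over `p` first, after the shift `p ↦ p - l`, reassembles the Taylor
remainder of `τ(·,θ)`. -/
theorem hasSum_synth_remCoeff (h0 : 0 < h) (h1 : h ≤ 1) (hδ : 0 ≤ δ) (hδ1 : δ < 1)
    (hσ : σ ∈ symbolClass h n μ₁ ρ δ) (hτ : τ ∈ symbolClass h n μ₂ ρ δ) (N : ℕ)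
    (k : lattice h n) (θ : Torus n) :
    HasSum (fun l => mFourierCoeff (σ k) l * mFourier l θ * taylorRem N (fun k' => τ k' θ) k l)
      (synth (remCoeff σ τ N k) θ) := by
  have hs0 := summable_remSummand h0 h1 hδ hδ1 hσ hτ N k
  have hs : Summable fun x : (Fin n → ℤ) × (Fin n → ℤ) =>
      remSummand σ τ N k x.1 x.2 * mFourier x.2 θ :=
    Summable.of_norm (hs0.congr fun x => by rw [norm_mul, norm_mFourier_apply, mul_one])
  have hfib1 : ∀ l, HasSum (fun p => remSummand σ τ N k l p * mFourier p θ)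
      (mFourierCoeff (σ k) l * mFourier l θ * taylorRem N (fun k' => τ k' θ) k l) := by
    intro l
    have h2 := (hasSum_taylorRem hτ.1 N k l θ).mul_left (mFourierCoeff (σ k) l * mFourier l θ)
    rw [← (Equiv.subRight l).hasSum_iff] at h2
    refine h2.congr_fun fun p => ?_
    have : mFourier p θ = mFourier (p - l) θ * mFourier l θ := by
      rw [← mFourier_add, sub_add_cancel]
    simp only [remSummand, Function.comp_apply, Equiv.subRight_apply, this]
    ring
  have hfib2 : ∀ p, HasSum (fun l => remSummand σ τ N k l p * mFourier p θ)
      (remCoeff σ τ N k p * mFourier p θ) := fun p =>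
    (Summable.of_norm (hs0.prod_symm.prod_factor p)).hasSum.mul_right _
  have h3 := hs.hasSum.prod_fiberwise hfib1
  have h4 := hs.prod_symm.hasSum.prod_fiberwise hfib2
  have h5 : ∑' x : (Fin n → ℤ) × (Fin n → ℤ), remSummand σ τ N k x.2 x.1 * mFourier x.1 θ =
      ∑' x : (Fin n → ℤ) × (Fin n → ℤ), remSummand σ τ N k x.1 x.2 * mFourier x.2 θ :=
    (Equiv.prodComm _ _).tsum_eq
      (fun x : (Fin n → ℤ) × (Fin n → ℤ) => remSummand σ τ N k x.1 x.2 * mFourier x.2 θ)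
  have h6 := h4.tsum_eq
  simp only [Prod.fst_swap, Prod.snd_swap] at h6
  rw [synth, h6, h5]
  exact h3

/-- The multiplier of `D^(α)` is `α! h^|α|` times the binomial coefficient of the Taylor term, so
the factor `1/α!` in the composition formula matches exactly. -/
theorem hasSum_compositionTerm (hσ : ∀ k, SmoothOnTorus (σ k)) (i : ℕ) (k : lattice h n)
    (θ : Torus n) :
    HasSum (fun l => mFourierCoeff (σ k) l * mFourier l θ * taylorTerm i (fun k' => τ k' θ) k l)
      (∑ α ∈ Finset.piAntidiag (Finset.univ : Finset (Fin n)) i, compositionTerm σ τ α k θ) := by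
  simp only [taylorTerm, Finset.mul_sum]
  refine hasSum_sum fun α hα => ?_
  rw [mem_piAntidiag_univ] at hα
  have h1 := ((hasSum_mFourierCoeff ((hσ k).torusDMulti (h := h) α) θ).mul_right
    (diffMulti α (fun m => τ m θ) k)).mul_left (1 / ((∏ j, (α j).factorial : ℕ) : ℂ))
  refine h1.congr_fun fun l => ?_
  have hne : ((∏ j, (α j).factorial : ℕ) : ℂ) ≠ 0 := by
    exact_mod_cast Finset.prod_ne_zero_iff.2 fun j _ => (α j).factorial_ne_zero
  have h2 : ∏ j, (h : ℂ) ^ α j * fallingFact (l j) (α j) =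
      (h : ℂ) ^ i * (((∏ j, (α j).factorial : ℕ) : ℂ) * multiChoose l α) := by
    rw [Finset.prod_mul_distrib, Finset.prod_pow_eq_pow_sum, hα, multiChoose, Nat.cast_prod,
      ← Finset.prod_mul_distrib]
    simp only [factorial_mul_choose_eq_fallingFact]
  rw [mFourierCoeff_torusDMulti (hσ k), h2]
  field_simp

/-- For `N = 0` nothing is subtracted in the Taylor remainder, so that series is the full symbol of
the composition. -/
theorem synth_remCoeff_eq (h0 : 0 < h) (h1 : h ≤ 1) (hδ : 0 ≤ δ) (hδ1 : δ < 1)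
    (hσ : σ ∈ symbolClass h n μ₁ ρ δ) (hτ : τ ∈ symbolClass h n μ₂ ρ δ) (N : ℕ)
    (k : lattice h n) (θ : Torus n) :
    synth (remCoeff σ τ N k) θ = synth (remCoeff σ τ 0 k) θ - ∑ i ∈ Finset.range N,
      ∑ α ∈ Finset.piAntidiag (Finset.univ : Finset (Fin n)) i, compositionTerm σ τ α k θ := by
  refine (hasSum_synth_remCoeff h0 h1 hδ hδ1 hσ hτ N k θ).unique ?_
  have h2 := (hasSum_synth_remCoeff h0 h1 hδ hδ1 hσ hτ 0 k θ).sub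
    (hasSum_sum fun i (_ : i ∈ Finset.range N) => hasSum_compositionTerm (τ := τ) hσ.1 i k θ)
  refine h2.congr_fun fun l => ?_
  simp only [taylorRem, Finset.range_zero, Finset.sum_empty, sub_zero, mul_sub, Finset.mul_sum]

end Remainder

/-! ### Symbol estimates from coefficient bounds, with a fixed loss. -/

section CrudeEstimate

variable {n : ℕ} {h ρ δ : ℝ}

/-- A momentum uses up one power of the weight. A difference is bounded by the triangle inequality
and Peetre's inequality, with no gain in `k`; the missing gains make up the loss `ρd`. -/
theorem symbolUpTo_synth (h0 : 0 < h) (h1 : h ≤ 1) (hρ : 0 ≤ ρ) (hδ : 0 ≤ δ) {s C : ℝ} {d : ℕ}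
    {a : lattice h n → (Fin n → ℤ) → ℂ} (ha : ∀ k, RapidDecay (a k))
    (hb : ∀ k m, ‖a k m‖ * wt m ^ (2 * n + d) ≤ C * (1 + ‖k‖) ^ s) :
    SymbolUpTo ρ δ d (s + ρ * d) fun k => synth (a k) := by
  induction d generalizing a C with
  | zero =>
    refine ⟨fun k => (ha k).smooth_synth, C * wtSum n, fun k θ => ?_⟩
    refine (norm_synth_le (hb k) θ).trans (le_of_eq ?_)
    simp; ring
  | succ d ih =>
    have hd : (0 : ℝ) ≤ d := Nat.cast_nonneg d
    have hle : ∀ (m : Fin n → ℤ), wt m ^ (2 * n + d) ≤ wt m ^ (2 * n + (d + 1)) := fun m =>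
      pow_le_pow_right₀ (one_le_wt m) (by omega)
    have hb' : ∀ k m, ‖a k m‖ * wt m ^ (2 * n + d) ≤ C * (1 + ‖k‖) ^ s := fun k m =>
      (mul_le_mul_of_nonneg_left (hle m) (norm_nonneg _)).trans (hb k m)
    refine ⟨(ih ha hb').bounded.mono ?_, fun j => ⟨?_, ?_⟩⟩
    · push_cast; nlinarith
    · have e : symbolMomentum j (fun k => synth (a k)) =
          fun k => synth fun m => (m j : ℂ) * a k m := funext fun k => momentum_synth (ha k) j
      rw [e]
      refine (ih (C := C) (fun k => (ha k).mul_of_le_wt (K := 1) fun m => by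
        rw [one_mul]; exact norm_coord_le_wt m j) fun k m => ?_).mono (by push_cast; nlinarith)
      refine le_trans ?_ (hb k m)
      rw [norm_mul, ← add_assoc, pow_succ, mul_comm ‖(m j : ℂ)‖, mul_assoc, mul_comm ‖(m j : ℂ)‖]
      have := pow_pos (wt_pos m) (2 * n + d)
      gcongr
      exact norm_coord_le_wt m j
    · have e : symbolDiff j (fun k => synth (a k)) = fun k => synth fun m =>
          (h : ℂ)⁻¹ * (a (k + latticeStep h j) m - a k m) := by
        funext k θ
        rw [symbolDiff_eq]
        simp only [synth]
        rw [neg_one_mul, ← sub_eq_add_neg, ← (summable_synth (ha _).summable_norm θ).tsum_sub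
          (summable_synth (ha _).summable_norm θ), ← tsum_mul_left]
        exact tsum_congr fun m => by ring
      rw [e]
      obtain ⟨T, hT⟩ := exists_nat_ge |s|
      have hbd : ∀ k m, ‖a (k + latticeStep h j) m‖ * wt m ^ (2 * n + d) ≤
          C * ((1 + ‖k‖) ^ s * wt (Pi.single j 1 : Fin n → ℤ) ^ T) := by
        intro k m
        have hC : 0 ≤ C := by
          have h2 : 0 ≤ ‖a k m‖ * wt m ^ (2 * n + d) :=
            mul_nonneg (norm_nonneg _) (pow_pos (wt_pos m) _).le
          exact nonneg_of_mul_nonneg_left (h2.trans (hb' k m))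
            (Real.rpow_pos_of_pos (one_add_norm_pos k) s)
        refine (hb' _ m).trans (mul_le_mul_of_nonneg_left ?_ hC)
        rw [← latticePoint_single]
        exact rpow_one_add_norm_add_le h0 h1 hT k _
      have hbd2 : ∀ k m, ‖(h : ℂ)⁻¹ * (a (k + latticeStep h j) m - a k m)‖ * wt m ^ (2 * n + d) ≤
          (‖(h : ℂ)⁻¹‖ * (C * wt (Pi.single j 1 : Fin n → ℤ) ^ T + C)) * (1 + ‖k‖) ^ s := by
        intro k m
        have hw := (pow_pos (wt_pos m) (2 * n + d)).le
        rw [norm_mul]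
        calc _ ≤ ‖(h : ℂ)⁻¹‖ * (‖a (k + latticeStep h j) m‖ + ‖a k m‖) * wt m ^ (2 * n + d) := by
              gcongr
              exact norm_sub_le _ _
          _ = ‖(h : ℂ)⁻¹‖ * (‖a (k + latticeStep h j) m‖ * wt m ^ (2 * n + d) +
                ‖a k m‖ * wt m ^ (2 * n + d)) := by ring
          _ ≤ ‖(h : ℂ)⁻¹‖ * (C * ((1 + ‖k‖) ^ s * wt (Pi.single j 1 : Fin n → ℤ) ^ T) +
                C * (1 + ‖k‖) ^ s) := by
              exact mul_le_mul_of_nonneg_left (add_le_add (hbd k m) (hb' k m)) (norm_nonneg _)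
          _ = _ := by ring
      refine (ih (fun k M => ?_) hbd2).mono (by push_cast; linarith)
      obtain ⟨C₁, hC₁⟩ := ha (k + latticeStep h j) M
      obtain ⟨C₂, hC₂⟩ := ha k M
      refine ⟨‖(h : ℂ)⁻¹‖ * (C₁ + C₂), fun m => ?_⟩
      have hw := (pow_pos (wt_pos m) M).le
      rw [norm_mul]
      calc _ ≤ ‖(h : ℂ)⁻¹‖ * (‖a (k + latticeStep h j) m‖ + ‖a k m‖) * wt m ^ M := by
            gcongr
            exact norm_sub_le _ _
        _ = ‖(h : ℂ)⁻¹‖ * (‖a (k + latticeStep h j) m‖ * wt m ^ M + ‖a k m‖ * wt m ^ M) := by ring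
        _ ≤ _ := by
            exact mul_le_mul_of_nonneg_left (add_le_add (hC₁ m) (hC₂ m)) (norm_nonneg _)

theorem SymbolUpTo.sum (h0 : 0 < h) (h1 : h ≤ 1) (hρ : 0 ≤ ρ) (hδ : 0 ≤ δ) {ι : Type*}
    (I : Finset ι) {μ : ℝ} {d : ℕ} {σ : ι → lattice h n → Torus n → ℂ}
    (hσ : ∀ i ∈ I, SymbolUpTo ρ δ d μ (σ i)) :
    SymbolUpTo ρ δ d μ fun k θ => ∑ i ∈ I, σ i k θ := by
  classical
  induction I using Finset.induction_on with
  | empty =>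
    -- The zero symbol is treated as a Fourier series with zero coefficients; this `s` gives order
    -- exactly `μ`.
    have h2 := symbolUpTo_synth h0 h1 hρ hδ (s := μ - ρ * d) (C := 0) (d := d)
      (a := fun (_ : lattice h n) (_ : Fin n → ℤ) => (0 : ℂ)) (fun _ M => ⟨0, fun m => by simp⟩)
      (fun k m => by simp)
    have h3 : synth (fun _ : Fin n → ℤ => (0 : ℂ)) = fun _ => 0 := by
      funext θ; simp [synth]
    simpa [h3, sub_add_cancel] using h2
  | insert i I hi ih =>
    simp only [Finset.sum_insert hi]
    exact (hσ i (Finset.mem_insert_self i I)).add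
      (ih fun i hi => hσ i (Finset.mem_insert_of_mem hi))

end CrudeEstimate

/-! ### The asymptotic expansion of the composed symbol. -/

section Asymptotics

variable {n : ℕ} {h ρ δ μ₁ μ₂ : ℝ} {σ τ : lattice h n → Torus n → ℂ}

/-- The symbol of the composition `Op(σ) ∘ Op(τ)`. -/
noncomputable def compositionSymbol (σ τ : lattice h n → Torus n → ℂ) :
    lattice h n → Torus n → ℂ := fun k => synth (remCoeff σ τ 0 k)

theorem isAsymptoticSum_compositionSymbol (h0 : 0 < h) (h1 : h ≤ 1) (hδ : 0 ≤ δ) (hδρ : δ < ρ)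
    (hρ : ρ ≤ 1) (hσ : σ ∈ symbolClass h n μ₁ ρ δ) (hτ : τ ∈ symbolClass h n μ₂ ρ δ) :
    IsAsymptoticSum (μ₁ + μ₂) ρ δ (compositionSymbol σ τ) (compositionTerm σ τ) := by
  intro N
  have hρ0 : 0 ≤ ρ := hδ.trans hδρ.le
  have hδ1 : δ < 1 := hδρ.trans_le hρ
  refine IsSymbol.mem_symbolClass hδ fun d => ?_
  -- `R(ρ-δ)` must exceed both losses: that of the coefficient bound with `M = 2n + d`, and `ρd`
  -- from the crude estimate. `R` may depend on `d`, as the symbol being estimated does not depend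
  -- on `R`.
  obtain ⟨R, hR⟩ := exists_nat_ge ((δ * (2 * (2 * n + d : ℕ) + 2 * n) + ρ * d) / (ρ - δ))
  rw [div_le_iff₀ (sub_pos.2 hδρ)] at hR
  obtain ⟨C, _, hC⟩ := exists_remCoeff_bound h0 h1 hδ hδ1 hσ hτ (N + R) (2 * n + d)
  have hrem := (symbolUpTo_synth h0 h1 hρ0 hδ
    (rapidDecay_remCoeff h0 h1 hδ hδ1 hσ hτ (N + R)) hC).mono
    (μ' := μ₁ + μ₂ - N * (ρ - δ)) (by push_cast at hR ⊢; linarith)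
  have hterms : SymbolUpTo ρ δ d (μ₁ + μ₂ - N * (ρ - δ)) fun k θ => ∑ i ∈ Finset.range R,
      ∑ α ∈ Finset.piAntidiag (Finset.univ : Finset (Fin n)) (N + i),
        compositionTerm σ τ α k θ := by
    refine SymbolUpTo.sum h0 h1 hρ0 hδ _ fun i _ => SymbolUpTo.sum h0 h1 hρ0 hδ _ fun α hα => ?_
    refine (isSymbol_compositionTerm h0.ne' hδ hρ0 (isSymbol_of_mem_symbolClass h0.ne' hδ hσ)
      (isSymbol_of_mem_symbolClass h0.ne' hδ hτ) α d).mono ?_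
    rw [mem_piAntidiag_univ.1 hα]
    have : (0 : ℝ) ≤ i * (ρ - δ) := mul_nonneg (Nat.cast_nonneg i) (sub_nonneg.2 hδρ.le)
    push_cast; linarith
  have hsum := hrem.add hterms
  have e : (fun k θ => compositionSymbol σ τ k θ - ∑ i ∈ Finset.range N,
      ∑ α ∈ Finset.piAntidiag (Finset.univ : Finset (Fin n)) i, compositionTerm σ τ α k θ) =
      fun k θ => synth (remCoeff σ τ (N + R) k) θ + ∑ i ∈ Finset.range R,
        ∑ α ∈ Finset.piAntidiag (Finset.univ : Finset (Fin n)) (N + i),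
          compositionTerm σ τ α k θ := by
    funext k θ
    rw [synth_remCoeff_eq h0 h1 hδ hδ1 hσ hτ, Finset.sum_range_add, compositionSymbol]
    ring
  rw [e]
  exact hsum

theorem compositionSymbol_mem_symbolClass (h0 : 0 < h) (h1 : h ≤ 1) (hδ : 0 ≤ δ) (hδρ : δ < ρ)
    (hρ : ρ ≤ 1) (hσ : σ ∈ symbolClass h n μ₁ ρ δ) (hτ : τ ∈ symbolClass h n μ₂ ρ δ) :
    compositionSymbol σ τ ∈ symbolClass h n (μ₁ + μ₂) ρ δ := by
  simpa using isAsymptoticSum_compositionSymbol h0 h1 hδ hδρ hρ hσ hτ 0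

end Asymptotics

/-! ### Operators as matrices on the lattice, and their composition. -/

section Operators

variable {n : ℕ} {h ρ δ μ μ₁ μ₂ : ℝ} {σ τ : lattice h n → Torus n → ℂ} {f : lattice h n → ℂ}

theorem mFourier_neg_right (m : Fin n → ℤ) (θ : Torus n) :
    mFourier m (-θ) = mFourier (-m) θ := by
  simp [mFourier, fourier_apply]

theorem wt_le_mul_one_add_norm (h0 : 0 < h) (l : Fin n → ℤ) :
    wt l ≤ (1 + n / h) * (1 + ‖latticePoint h l‖) := by
  have hl : lnorm l ≤ n / h * ‖latticePoint h l‖ := by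
    have h1 : ∀ j, |(l j : ℝ)| ≤ ‖latticePoint h l‖ / h := by
      intro j
      have h2 := PiLp.norm_apply_le (latticePoint h l : EuclideanSpace ℝ (Fin n)) j
      rw [latticePoint_apply, norm_mul, Real.norm_of_nonneg h0.le, Real.norm_eq_abs] at h2
      rw [le_div_iff₀ h0, mul_comm]
      exact h2
    calc lnorm l ≤ ∑ _j : Fin n, ‖latticePoint h l‖ / h := Finset.sum_le_sum fun j _ => h1 j
      _ = _ := by simp; ring
  have h2 : 0 ≤ (n : ℝ) / h := by positivity
  have h3 := norm_nonneg (latticePoint h l)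
  unfold wt
  nlinarith

theorem summable_norm_of_mem_schwartzSpace (h0 : 0 < h) (hf : f ∈ schwartzSpace h n) :
    Summable fun m => ‖f m‖ := by
  obtain ⟨C, hC⟩ := hf (2 * n)
  rw [← (latticeEquiv h0.ne' (0 : lattice h n)).summable_iff]
  have hb : ∀ l : Fin n → ℤ, ‖f (latticePoint h l)‖ * wt l ^ (2 * n) ≤
      C * (1 + n / h) ^ (2 * n) := by
    intro l
    have hk := one_add_norm_pos (latticePoint h l)
    have h1 := hC (latticePoint h l)
    rw [Real.rpow_neg hk.le, Real.rpow_natCast, ← div_eq_mul_inv,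
      le_div_iff₀ (pow_pos hk _)] at h1
    have h2 := pow_le_pow_left₀ (wt_pos l).le (wt_le_mul_one_add_norm h0 l) (2 * n)
    rw [mul_pow] at h2
    calc _ ≤ ‖f (latticePoint h l)‖ * ((1 + n / h) ^ (2 * n) *
          (1 + ‖latticePoint h l‖) ^ (2 * n)) := by gcongr
      _ = (‖f (latticePoint h l)‖ * (1 + ‖latticePoint h l‖) ^ (2 * n)) *
          (1 + n / h) ^ (2 * n) := by ring
      _ ≤ _ := by gcongr
  refine (summable_norm_of_wt_bound hb).congr fun l => ?_
  simp [latticeEquiv]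

theorem summable_norm_shift (h0 : 0 < h) (hf : f ∈ schwartzSpace h n) (k : lattice h n) :
    Summable fun l => ‖f (k + latticePoint h l)‖ :=
  (latticeEquiv h0.ne' k).summable_iff.2 (summable_norm_of_mem_schwartzSpace h0 hf)

/-- Summing over `k + hl` instead of over lattice points cancels the character of `k`. -/
theorem latticeChar_mul_latticeFourier (h0 : 0 < h) (f : lattice h n → ℂ) (k : lattice h n)
    (θ : Torus n) : latticeChar k θ * latticeFourier f θ =
      ∑' l, mFourier (-l) θ * f (k + latticePoint h l) := by
  rw [latticeFourier, ← (latticeEquiv h0.ne' k).tsum_eq, ← tsum_mul_left]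
  refine tsum_congr fun l => ?_
  change latticeChar k θ * (latticeChar (k + latticePoint h l) (-θ) * f (k + latticePoint h l)) = _
  have h1 : (-l : Fin n → ℤ) = latticeCoord k + -(latticeCoord k + l) := by abel
  rw [latticeChar, latticeChar, mFourier_neg_right, latticeCoord_add_latticePoint h0.ne', h1,
    mFourier_add]
  ring

theorem Op_eq_tsum (h0 : 0 < h) (hσ : ∀ k, SmoothOnTorus (σ k)) (hf : f ∈ schwartzSpace h n)
    (k : lattice h n) :
    Op σ f k = ∑' l, mFourierCoeff (σ k) l * f (k + latticePoint h l) := by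
  obtain ⟨C, hC⟩ := exists_bound_of_continuous (hσ k).continuous
  have h1 : ∀ θ, latticeChar k θ * σ k θ * latticeFourier f θ =
      ∑' l, (mFourier (-l) θ * σ k θ) * f (k + latticePoint h l) := by
    intro θ
    rw [mul_right_comm, latticeChar_mul_latticeFourier h0, ← tsum_mul_right]
    exact tsum_congr fun l => mul_right_comm _ _ _
  unfold Op
  simp only [h1]
  rw [integral_tsum_torus
    (F := fun l θ => (mFourier (-l) θ * σ k θ) * f (k + latticePoint h l))
    (u := fun l => C * ‖f (k + latticePoint h l)‖)
    (fun l => ((mFourier (-l)).continuous.mul (hσ k).continuous).mul continuous_const)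
    ((summable_norm_shift h0 hf k).mul_left C) fun l θ => by
      rw [norm_mul, norm_mul, norm_mFourier_apply, one_mul]
      exact mul_le_mul_of_nonneg_right (hC θ) (norm_nonneg _)]
  simp only [integral_mul_const, mFourierCoeff_eq]

theorem Op_mem_schwartzSpace (h0 : 0 < h) (h1 : h ≤ 1) (hδ : 0 ≤ δ) (hδ1 : δ < 1)
    (hσ : σ ∈ symbolClass h n μ ρ δ) (hf : f ∈ schwartzSpace h n) : Op σ f ∈ schwartzSpace h n := by
  intro N
  -- Using `R` orders of decay of `f` gains `(1+|k|)^(-R)` by Peetre's inequality, while the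
  -- resulting powers of `wt l` cost `δR` through `σ`. As `δ < 1`, the net gain exceeds any
  -- prescribed order.
  obtain ⟨R, hR⟩ := exists_nat_ge ((N + μ + δ * (2 * n)) / (1 - δ))
  rw [div_le_iff₀ (by linarith)] at hR
  obtain ⟨Cf, hCf⟩ := hf R
  obtain ⟨C, hC, hb⟩ := exists_coeff_decay_zero h0 hδ hσ (R + 2 * n)
  have hCf0 : 0 ≤ Cf := by
    have := (norm_nonneg _).trans (hCf 0)
    simpa using this
  refine ⟨Cf * C * wtSum n, fun k => ?_⟩
  have hk := one_le_one_add_norm k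
  have hk0 := one_add_norm_pos k
  have hkR := Real.rpow_nonneg hk0.le (-(R : ℝ))
  have hterm : ∀ l, ‖mFourierCoeff (σ k) l * f (k + latticePoint h l)‖ * wt l ^ (2 * n) ≤
      Cf * C * (1 + ‖k‖) ^ (-(N : ℝ)) := by
    intro l
    have hl := wt_pos l
    have h2 : ‖f (k + latticePoint h l)‖ ≤ Cf * ((1 + ‖k‖) ^ (-(R : ℝ)) * wt l ^ R) :=
      (hCf _).trans (mul_le_mul_of_nonneg_left
        (rpow_one_add_norm_add_le h0 h1 (by simp) k l) hCf0)
    rw [norm_mul]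
    calc _ ≤ ‖mFourierCoeff (σ k) l‖ * (Cf * ((1 + ‖k‖) ^ (-(R : ℝ)) * wt l ^ R)) *
          wt l ^ (2 * n) := by gcongr
      _ = Cf * (1 + ‖k‖) ^ (-(R : ℝ)) * (‖mFourierCoeff (σ k) l‖ * wt l ^ (R + 2 * n)) := by ring
      _ ≤ Cf * (1 + ‖k‖) ^ (-(R : ℝ)) * (C * (1 + ‖k‖) ^ (μ + δ * ((R + 2 * n : ℕ) : ℝ))) := by
        exact mul_le_mul_of_nonneg_left (hb k l) (mul_nonneg hCf0 hkR)
      _ = Cf * C * ((1 + ‖k‖) ^ (-(R : ℝ)) * (1 + ‖k‖) ^ (μ + δ * ((R + 2 * n : ℕ) : ℝ))) := by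
        ring
      _ ≤ _ := by
        rw [← Real.rpow_add hk0]
        refine mul_le_mul_of_nonneg_left (Real.rpow_le_rpow_of_exponent_le hk ?_)
          (mul_nonneg hCf0 hC)
        push_cast; linarith
  rw [Op_eq_tsum h0 hσ.1 hf]
  have h3 := tsum_norm_le_of_wt_bound
    (a := fun l => mFourierCoeff (σ k) l * f (k + latticePoint h l)) hterm
  have h4 := summable_norm_of_wt_bound
    (a := fun l => mFourierCoeff (σ k) l * f (k + latticePoint h l)) hterm
  have h5 := (norm_tsum_le_tsum_norm h4).trans h3
  calc _ ≤ _ := h5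
    _ = _ := by ring

theorem Op_comp_eq (h0 : 0 < h) (h1 : h ≤ 1) (hδ : 0 ≤ δ) (hδ1 : δ < 1)
    (hσ : σ ∈ symbolClass h n μ₁ ρ δ) (hτ : τ ∈ symbolClass h n μ₂ ρ δ)
    (hf : f ∈ schwartzSpace h n) : Op σ (Op τ f) = Op (compositionSymbol σ τ) f := by
  funext k
  have hrd := rapidDecay_remCoeff h0 h1 hδ hδ1 hσ hτ 0
  rw [Op_eq_tsum h0 hσ.1 (Op_mem_schwartzSpace h0 h1 hδ hδ1 hτ hf),
    Op_eq_tsum (σ := compositionSymbol σ τ) h0 (fun k => (hrd k).smooth_synth) hf]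
  -- For fixed `k` the matrix entries are already absolutely summable over both indices, so
  -- boundedness of `f` suffices for exchanging the sums.
  obtain ⟨C, hC⟩ := hf 0
  have hs0 := summable_remSummand h0 h1 hδ hδ1 hσ hτ 0 k
  have hs : Summable fun x : (Fin n → ℤ) × (Fin n → ℤ) =>
      remSummand σ τ 0 k x.1 x.2 * f (k + latticePoint h x.2) := by
    refine Summable.of_norm_bounded (hs0.mul_right C) fun x => ?_
    rw [norm_mul]
    refine mul_le_mul_of_nonneg_left ?_ (norm_nonneg _)
    simpa using hC (k + latticePoint h x.2)
  have h2 : ∀ l, mFourierCoeff (σ k) l * Op τ f (k + latticePoint h l) =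
      ∑' p, remSummand σ τ 0 k l p * f (k + latticePoint h p) := by
    intro l
    rw [Op_eq_tsum h0 hτ.1 hf, ← tsum_mul_left, ← (Equiv.subRight l).tsum_eq]
    refine tsum_congr fun p => ?_
    rw [Equiv.subRight_apply, add_assoc, ← latticePoint_add, add_sub_cancel]
    simp only [remSummand, taylorRem, Finset.range_zero, Finset.sum_empty, sub_zero]
    ring
  have h3 : ∀ p, mFourierCoeff (compositionSymbol σ τ k) p * f (k + latticePoint h p) =
      ∑' l, remSummand σ τ 0 k l p * f (k + latticePoint h p) := by
    intro p
    rw [compositionSymbol, mFourierCoeff_synth (hrd k).summable_norm, remCoeff, tsum_mul_right]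
  rw [tsum_congr h2, tsum_congr h3]
  exact (Summable.tsum_comm
    (f := fun l p => remSummand σ τ 0 k l p * f (k + latticePoint h p)) hs).symm

end Operators

end SemiclassicalLattice

/-! ### The composition theorem. -/

theorem mainTheorem1 (n : ℕ) (h : ℝ) (hh0 : 0 < h) (hh1 : h ≤ 1)
    (ρ δ μ₁ μ₂ : ℝ) (hδ : 0 ≤ δ) (hδρ : δ < ρ) (hρ : ρ ≤ 1)
    (σ τ : SemiclassicalLattice.lattice h n → SemiclassicalLattice.Torus n → ℂ)
    (hσ : σ ∈ SemiclassicalLattice.symbolClass h n μ₁ ρ δ)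
    (hτ : τ ∈ SemiclassicalLattice.symbolClass h n μ₂ ρ δ) :
    Set.MapsTo (SemiclassicalLattice.Op τ) (SemiclassicalLattice.schwartzSpace h n)
        (SemiclassicalLattice.schwartzSpace h n) ∧
      Set.MapsTo (SemiclassicalLattice.Op σ) (SemiclassicalLattice.schwartzSpace h n)
        (SemiclassicalLattice.schwartzSpace h n) ∧
      ∃ ς ∈ SemiclassicalLattice.symbolClass h n (μ₁ + μ₂) ρ δ,
        (∀ f ∈ SemiclassicalLattice.schwartzSpace h n,
          (SemiclassicalLattice.Op σ ∘ SemiclassicalLattice.Op τ) f =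
            SemiclassicalLattice.Op ς f) ∧
        SemiclassicalLattice.IsAsymptoticSum (μ₁ + μ₂) ρ δ ς
          (SemiclassicalLattice.compositionTerm σ τ) :=
  have hδ1 : δ < 1 := hδρ.trans_le hρ
  ⟨fun _ hf => SemiclassicalLattice.Op_mem_schwartzSpace hh0 hh1 hδ hδ1 hτ hf,
    fun _ hf => SemiclassicalLattice.Op_mem_schwartzSpace hh0 hh1 hδ hδ1 hσ hf,
    SemiclassicalLattice.compositionSymbol σ τ,
    SemiclassicalLattice.compositionSymbol_mem_symbolClass hh0 hh1 hδ hδρ hρ hσ hτ,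
    fun _ hf => SemiclassicalLattice.Op_comp_eq hh0 hh1 hδ hδ1 hσ hτ hf,
    SemiclassicalLattice.isAsymptoticSum_compositionSymbol hh0 hh1 hδ hδρ hρ hσ hτ⟩
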